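/- A relational event graph $G$ consists of a vertex set $V=\{0,\dots,n-1\}$ and a sequence of edges $e_0,\dots,e_{m-1}$, each joining a pair of vertices (repeated pairs and loops are allowed; directions, if given, are ignored). For $0\le i\le j<m$ the slice $G_{i,j}$ is the multigraph with vertex set $V$ and edges $e_i,\dots,e_j$. A connected component of a slice is *loopy* if it contains at least one cycle (a loop is a cycle of length one, and two parallel edges form a cycle of length two), and a *tree component* otherwise; a tree component is *nontrivial* if it has more than one vertex. A dominance counting data set is a set of at most $N$ integer points $(x,y)$ with $1\le y\le x\le N$; a dominance counting query asks for the number of its points in one of the four closed axis-parallel quadrants at a query point $(x_0,y_0)$. A quantity $f$ of slices is said to be reducible to dominance counting in time $O(T(n,m))$ and linear space if there are a random access machine program, a constant $C$ and a finite list of dominance queries, none of them depending on $G$, such that for every $G$ the program, given $n$, $m$ and the endpoints of $e_0,\dots,e_{m-1}$ (all other memory being zero), halts within $C\,T(n,m)$ steps, using a fixed number of registers and of arrays with at most $C(n+m+1)$ cells each, all words being natural numbers below $C(n+m+1)$, and leaves in memory finitely many dominance counting data sets with $N\le Cm$, such that for all $0\le i\le j<m$ the value $f(G_{i,j})$ is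 the sum of an affine form in $n,m,i,j$ with fixed integer coefficients and a fixed integer linear combination of the counts of the listed dominance queries on these data sets, where the coordinates of the query points are affine forms in $n,m,i,j$ with fixed integer coefficients. **Theorem.** Each of the following quantities of the slices $G_{i,j}$ of a relational event graph is reducible to dominance counting in time $O(m\log n)$ and linear space: the number of loopy components, the number of tree components, and the number of nontrivial tree components. Here $O(m\log n)$ is read as $O(m(\lfloor\log_2 n\rfloor+1)+1)$, so that the cases $n\le 1$ and $m=0$ are covered. -/

import Mathlib

/-! ## Components of multigraphs -/

namespace Graph

variable {α β : Type*}

/-- A cycle of length `l + 1` in a multigraph: distinct vertices `v 0, …, v l` and distinct edges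
`e 0, …, e l`, where `e t` joins `v t` to `v (t + 1)` and the index `t + 1` is taken modulo
`l + 1`. A loop is a cycle of length one, two parallel edges form a cycle of length two. -/
structure IsCycleOn (G : Graph α β) {l : ℕ} (v : Fin (l + 1) → α) (e : Fin (l + 1) → β) :
    Prop where
  vertex_injective : Function.Injective v
  edge_injective : Function.Injective e
  isLink : ∀ t, G.IsLink (e t) (v t) (v (t + 1))

/-- The connected components of a multigraph (those of its underlying simple graph). -/
abbrev Component (G : Graph α β) : Type _ := G.toSimpleGraph.ConnectedComponent

/-- A component is loopy if it contains at least one cycle. -/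
def IsLoopy (G : Graph α β) (c : G.Component) : Prop :=
  ∃ (l : ℕ) (v : Fin (l + 1) → G.vertexSet) (e : Fin (l + 1) → β),
    G.IsCycleOn (fun t => (v t : α)) e ∧ ∀ t, v t ∈ c.supp

/-- A component is a tree if it contains no cycle (it is connected, being a component). -/
def IsTreeComponent (G : Graph α β) (c : G.Component) : Prop := ¬ G.IsLoopy c

/-- The number of loopy components. -/
noncomputable def loopyComponentCount (G : Graph α β) : ℕ :=
  Nat.card {c : G.Component // G.IsLoopy c}

/-- The number of tree components, single vertices without edges included. -/
noncomputable def treeComponentCount (G : Graph α β) : ℕ :=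
  Nat.card {c : G.Component // G.IsTreeComponent c}

/-- The number of tree components with more than one vertex. -/
noncomputable def nontrivialTreeComponentCount (G : Graph α β) : ℕ :=
  Nat.card {c : G.Component // G.IsTreeComponent c ∧ c.supp.Nontrivial}

end Graph

/-! ## Relational event graphs and their slices -/

/-- A relational event graph: a vertex set `{0, …, n - 1}` and a sequence of `m` edges, each given
by the pair of its endpoints. Pairs may repeat. The order inside a pair plays no role for the
components of slices, so directed and undirected event graphs are both covered. -/
structure RelationalEventGraph where
  n : ℕ
  m : ℕ
  edge : Fin m → Fin n × Fin n

/-- The slice multigraph `G_{i,j}`: all the vertices, and the edges `e_k` with `i ≤ k ≤ j`. -/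
def RelationalEventGraph.slice (G : RelationalEventGraph) (i j : ℕ) :
    Graph (Fin G.n) (Fin G.m) where
  vertexSet := Set.univ
  IsLink k u v := (i ≤ (k : ℕ) ∧ (k : ℕ) ≤ j) ∧ (G.edge k = (u, v) ∨ G.edge k = (v, u))
  isLink_symm := fun _ _ => ⟨fun _ _ h => ⟨h.1, h.2.symm⟩⟩
  eq_or_eq_of_isLink_of_isLink := by
    rintro k x y v w ⟨-, h | h⟩ ⟨-, h' | h'⟩ <;> rw [h] at h' <;> simp_all
  left_mem_of_isLink := fun _ _ _ _ => Set.mem_univ _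

/-! ## A random access machine with a step count

Programs of a structured imperative language over words: a fixed finite number of registers and of
arrays, with addition, (truncated) subtraction, comparison and indirect addressing. Every
elementary operation costs one step. The machine is restricted: words hold numbers below `W`, and
arrays have `S` cells each. An overflowing operation or an access outside of an array has no
result, so that a program that attempts it has no run. -/

namespace RAM

/-- Memory contents: registers and arrays, each addressed by natural numbers. -/
structure Memory where
  reg : ℕ → ℕ
  arr : ℕ → ℕ → ℕ

def Memory.setReg (σ : Memory) (x v : ℕ) : Memory :=
  { σ with reg := Function.update σ.reg x v }

def Memory.setArr (σ : Memory) (a i v : ℕ) : Memory :=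
  { σ with arr := Function.update σ.arr a (Function.update (σ.arr a) i v) }

inductive Expr where
  | lit (c : ℕ)
  | reg (x : ℕ)
  | get (a : ℕ) (i : Expr)
  | add (e₁ e₂ : Expr)
  | sub (e₁ e₂ : Expr)

/-- A word: a number below `W`. -/
def toWord (W v : ℕ) : Option ℕ := if v < W then some v else none

/-- The value of an expression on the machine with word bound `W` and `S` cells per array. -/
def Expr.eval (W S : ℕ) (σ : Memory) : Expr → Option ℕ
  | .lit c => toWord W c
  | .reg x => toWord W (σ.reg x)
  | .get a i => do
      let k ← i.eval W S σ
      if k < S then toWord W (σ.arr a k) else none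
  | .add e₁ e₂ => do
      let v₁ ← e₁.eval W S σ
      let v₂ ← e₂.eval W S σ
      toWord W (v₁ + v₂)
  | .sub e₁ e₂ => do
      let v₁ ← e₁.eval W S σ
      let v₂ ← e₂.eval W S σ
      toWord W (v₁ - v₂)

/-- The number of steps to evaluate an expression: one for each operation in it. -/
def Expr.cost : Expr → ℕ
  | .lit _ => 1
  | .reg _ => 1
  | .get _ i => i.cost + 1
  | .add e₁ e₂ => e₁.cost + e₂.cost + 1
  | .sub e₁ e₂ => e₁.cost + e₂.cost + 1

/-- Tests. -/
inductive Cond where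
  | eq (e₁ e₂ : Expr)
  | lt (e₁ e₂ : Expr)
  | not (b : Cond)
  | and (b₁ b₂ : Cond)

def Cond.eval (W S : ℕ) (σ : Memory) : Cond → Option Bool
  | .eq e₁ e₂ => do
      let v₁ ← e₁.eval W S σ
      let v₂ ← e₂.eval W S σ
      return decide (v₁ = v₂)
  | .lt e₁ e₂ => do
      let v₁ ← e₁.eval W S σ
      let v₂ ← e₂.eval W S σ
      return decide (v₁ < v₂)
  | .not b => do
      let v ← b.eval W S σ
      return !v
  | .and b₁ b₂ => do
      let v₁ ← b₁.eval W S σ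
      let v₂ ← b₂.eval W S σ
      return v₁ && v₂

def Cond.cost : Cond → ℕ
  | .eq e₁ e₂ => e₁.cost + e₂.cost + 1
  | .lt e₁ e₂ => e₁.cost + e₂.cost + 1
  | .not b => b.cost + 1
  | .and b₁ b₂ => b₁.cost + b₂.cost + 1

inductive Program where
  | skip
  | assign (x : ℕ) (e : Expr)
  | store (a : ℕ) (i e : Expr)
  | seq (p q : Program)
  | ite (b : Cond) (p q : Program)
  | while (b : Cond) (p : Program)

/-- `Run W S p σ t τ`: on the machine with word bound `W` and `S` cells per array, the program `p`
started with memory `σ` halts after exactly `t` steps with memory `τ`. -/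
inductive Run (W S : ℕ) : Program → Memory → ℕ → Memory → Prop where
  | skip (σ : Memory) : Run W S .skip σ 1 σ
  | assign {x : ℕ} {e : Expr} {σ : Memory} {v : ℕ} (he : e.eval W S σ = some v) :
      Run W S (.assign x e) σ (e.cost + 1) (σ.setReg x v)
  | store {a : ℕ} {i e : Expr} {σ : Memory} {k v : ℕ} (hi : i.eval W S σ = some k) (hk : k < S)
      (he : e.eval W S σ = some v) :
      Run W S (.store a i e) σ (i.cost + e.cost + 1) (σ.setArr a k v)
  | seq {p q : Program} {σ σ' σ'' : Memory} {t t' : ℕ} (hp : Run W S p σ t σ')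
      (hq : Run W S q σ' t' σ'') : Run W S (.seq p q) σ (t + t') σ''
  | ite_true {b : Cond} {p q : Program} {σ σ' : Memory} {t : ℕ} (hb : b.eval W S σ = some true)
      (hp : Run W S p σ t σ') : Run W S (.ite b p q) σ (b.cost + 1 + t) σ'
  | ite_false {b : Cond} {p q : Program} {σ σ' : Memory} {t : ℕ} (hb : b.eval W S σ = some false)
      (hq : Run W S q σ t σ') : Run W S (.ite b p q) σ (b.cost + 1 + t) σ'
  | while_true {b : Cond} {p : Program} {σ σ' σ'' : Memory} {t t' : ℕ}
      (hb : b.eval W S σ = some true) (hp : Run W S p σ t σ')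
      (hw : Run W S (.while b p) σ' t' σ'') : Run W S (.while b p) σ (b.cost + 1 + t + t') σ''
  | while_false {b : Cond} {p : Program} {σ : Memory} (hb : b.eval W S σ = some false) :
      Run W S (.while b p) σ (b.cost + 1) σ

/-- The memory at the start: `n` and `m` in the registers `0` and `1`, the two endpoints of `e_k`
in the cells `k` of the arrays `0` and `1`, and zeros elsewhere. -/
def input (G : RelationalEventGraph) : Memory where
  reg x := if x = 0 then G.n else if x = 1 then G.m else 0
  arr a k :=
    if h : k < G.m then
      if a = 0 then ((G.edge ⟨k, h⟩).1 : ℕ) else if a = 1 then ((G.edge ⟨k, h⟩).2 : ℕ) else 0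
    else 0

end RAM

/-! ## Reductions to dominance counting -/

/-- A data set for dominance counting, listed without repetition: at most `N` points of the integer
grid with `1 ≤ y ≤ x ≤ N`. -/
structure IsDominanceData (N : ℕ) (P : List (ℕ × ℕ)) : Prop where
  nodup : P.Nodup
  length_le : P.length ≤ N
  mem_grid : ∀ p ∈ P, 1 ≤ p.2 ∧ p.2 ≤ p.1 ∧ p.1 ≤ N

/-- The place of a point set in the memory of the machine: the register with the number of points
and the arrays with their `x`- and `y`-coordinates. -/
structure PointSetLocation where
  countReg : ℕ
  xArr : ℕ
  yArr : ℕ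

def PointSetLocation.points (L : PointSetLocation) (σ : RAM.Memory) : List (ℕ × ℕ) :=
  (List.range (σ.reg L.countReg)).map fun t => (σ.arr L.xArr t, σ.arr L.yArr t)

/-- One of the four quadrants at a query point `(x₀, y₀)`: `x ≤ x₀` if `left` holds and `x₀ ≤ x`
otherwise, `y ≤ y₀` if `below` holds and `y₀ ≤ y` otherwise. -/
structure Quadrant where
  left : Bool
  below : Bool

/-- The dominance counting query: the number of points in a quadrant at `(x₀, y₀)`. -/
def dominanceCount (P : List (ℕ × ℕ)) (q : Quadrant) (x₀ y₀ : ℤ) : ℕ :=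
  P.countP fun p =>
    (if q.left then decide ((p.1 : ℤ) ≤ x₀) else decide (x₀ ≤ (p.1 : ℤ))) &&
    (if q.below then decide ((p.2 : ℤ) ≤ y₀) else decide (y₀ ≤ (p.2 : ℤ)))

/-- A form `cn * n + cm * m + ci * i + cj * j + c` with integer coefficients. -/
structure AffineForm where
  cn : ℤ
  cm : ℤ
  ci : ℤ
  cj : ℤ
  c : ℤ

def AffineForm.eval (f : AffineForm) (n m i j : ℕ) : ℤ :=
  f.cn * n + f.cm * m + f.ci * i + f.cj * j + f.c

/-- One dominance counting query made for a slice query: the point set that is queried, the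
quadrant, the query point in terms of the slice, and the coefficient of the count. -/
structure DominanceQuery where
  coeff : ℤ
  source : PointSetLocation
  quadrant : Quadrant
  x : AffineForm
  y : AffineForm

/-- A scheme for answering slice queries: a fixed list of dominance counting queries, whose counts
are combined linearly and added to an affine form in `n`, `m`, `i`, `j`. -/
structure QueryScheme where
  base : AffineForm
  queries : List DominanceQuery

/-- The answer to the slice query `(i, j)`, from the point sets in the memory `σ`. -/
def QueryScheme.answer (s : QueryScheme) (σ : RAM.Memory) (n m i j : ℕ) : ℤ :=
  s.base.eval n m i j +
    (s.queries.map fun d => d.coeff *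
      (dominanceCount (d.source.points σ) d.quadrant (d.x.eval n m i j) (d.y.eval n m i j) : ℤ)).sum

/-- The problem of determining the quantity `f H` for the slices `H = G_{i,j}` of a relational event
graph `G` can be reduced to dominance counting in time `O(time n m)` and space `O(space n m)`: a
program of the random access machine, with words of `log (n + m) + O(1)` bits, computes from every
`G` point sets with `O(1)` points per edge, such that each slice query is answered by a constant
number of dominance counting queries on them. The program, the scheme of the queries and the
constant `C` are the same for all `G`. -/
def ReducesToDominanceCounting (f : ∀ {n m : ℕ}, Graph (Fin n) (Fin m) → ℕ)
    (time space : ℕ → ℕ → ℕ) : Prop :=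
  ∃ (p : RAM.Program) (s : QueryScheme) (C : ℕ), ∀ G : RelationalEventGraph,
    ∃ (t : ℕ) (σ : RAM.Memory),
      RAM.Run (C * (G.n + G.m + 1)) (C * space G.n G.m) p (RAM.input G) t σ ∧
      t ≤ C * time G.n G.m ∧
      (∀ d ∈ s.queries, ∃ N ≤ C * G.m, IsDominanceData N (d.source.points σ)) ∧
      ∀ i j : ℕ, i ≤ j → j < G.m → (f (G.slice i j) : ℤ) = s.answer σ G.n G.m i j

/-! Give the edge `e_k` the weight `k + 1`. Among `e_0, …, e_j`, the edges of the slice `G_{i,j}`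
are those of weight at least `θ = i + 1`. Hence a maximum spanning tree of the first `j + 1` edges,
cut at the threshold `θ`, shows the components of `G_{i,j}`. Vertices are counted from one, and a
root `0` is joined to all of them by edges of weight `0`, so that there is always a tree with `n`
edges. At a threshold `θ ≥ 1`, the number of classes without the root is `n` minus the number of
tree edges of weight at least `θ` (`WF.card_add_heavyCount`).

Every insertion makes exactly one edge superfluous. So the number of heavy tree edges is the number
of heavy insertions minus the number of heavy superfluous weights. The superfluous weight `r_k`
found at time `k` never changes afterwards, hence the last number counts the points with `k ≤ j` and
`r_k ≥ i + 1`, which is a dominance count.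

Three trees are maintained. The first one holds the edges of the graph. Its `r_k` is at least `θ`
exactly when `e_k` has weight at least `θ` and its ends are connected by earlier edges of weight at
least `θ`, that is, when `e_k` is the latest edge of a cycle in the slice (`exists_cycle`,
`exists_of_isLoopy`). The second tree holds, in addition to `e_k`, an edge of weight `r_k` from an
end of `e_k` to the root. This merges all loopy components into the class of the root and leaves the
tree components as the other classes. The third tree joins both ends of `e_k` to the root with
weight `k + 1`, and its other classes are the vertices without edges. The three quantities are
linear in these counts.

For the running time, a tree need not be the spanning tree itself. It suffices that it has the same
connections at every threshold, which allows a local restructuring (`promote`) that lifts a vertex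
by one level. Lifting both ends of a new edge to the top and making one the parent of the other
turns the insertion into a comparison with a parallel tree edge. A potential argument with
logarithms of subtree sizes bounds the amortized cost by `O(log n)` (`WF.credit_promote_lt`). -/

/-! ## A program logic for the random access machine -/

namespace RAM

/-- The value of an expression on the machine without bounds. -/
def Expr.val (σ : Memory) : Expr → ℕ
  | .lit c => c
  | .reg x => σ.reg x
  | .get a i => σ.arr a (i.val σ)
  | .add e₁ e₂ => e₁.val σ + e₂.val σ
  | .sub e₁ e₂ => e₁.val σ - e₂.val σ

/-- The evaluation of the expression stays within the bounds of the machine. -/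
def Expr.Fits (W S : ℕ) (σ : Memory) : Expr → Prop
  | .lit c => c < W
  | .reg x => σ.reg x < W
  | .get a i => i.Fits W S σ ∧ i.val σ < S ∧ σ.arr a (i.val σ) < W
  | .add e₁ e₂ => e₁.Fits W S σ ∧ e₂.Fits W S σ ∧ e₁.val σ + e₂.val σ < W
  | .sub e₁ e₂ => e₁.Fits W S σ ∧ e₂.Fits W S σ

theorem Expr.Fits.val_lt {W S : ℕ} {σ : Memory} {e : Expr} (h : e.Fits W S σ) : e.val σ < W := by
  induction e with
  | lit c => exact h
  | reg x => exact h
  | get a i ih => exact h.2.2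
  | add e₁ e₂ ih₁ ih₂ => exact h.2.2
  | sub e₁ e₂ ih₁ ih₂ => exact (Nat.sub_le _ _).trans_lt (ih₁ h.1)

theorem Expr.Fits.eval_eq {W S : ℕ} {σ : Memory} {e : Expr} (h : e.Fits W S σ) :
    e.eval W S σ = some (e.val σ) := by
  induction e with
  | lit c => exact if_pos h
  | reg x => exact if_pos h
  | get a i ih =>
    simp only [Expr.eval, ih h.1, Option.bind_eq_bind, Option.bind_some, if_pos h.2.1]
    exact if_pos h.2.2
  | add e₁ e₂ ih₁ ih₂ =>
    simp only [Expr.eval, ih₁ h.1, ih₂ h.2.1, Option.bind_eq_bind, Option.bind_some]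
    exact if_pos h.2.2
  | sub e₁ e₂ ih₁ ih₂ =>
    simp only [Expr.eval, ih₁ h.1, ih₂ h.2, Option.bind_eq_bind, Option.bind_some]
    exact if_pos h.val_lt

/-- The truth of a test on the machine without bounds. -/
def Cond.Holds (σ : Memory) : Cond → Prop
  | .eq e₁ e₂ => e₁.val σ = e₂.val σ
  | .lt e₁ e₂ => e₁.val σ < e₂.val σ
  | .not b => ¬ b.Holds σ
  | .and b₁ b₂ => b₁.Holds σ ∧ b₂.Holds σ

/-- The evaluation of the test stays within the bounds of the machine. -/
def Cond.Fits (W S : ℕ) (σ : Memory) : Cond → Prop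
  | .eq e₁ e₂ => e₁.Fits W S σ ∧ e₂.Fits W S σ
  | .lt e₁ e₂ => e₁.Fits W S σ ∧ e₂.Fits W S σ
  | .not b => b.Fits W S σ
  | .and b₁ b₂ => b₁.Fits W S σ ∧ b₂.Fits W S σ

theorem Cond.Fits.exists_eval_eq {W S : ℕ} {σ : Memory} {b : Cond} (h : b.Fits W S σ) :
    ∃ c, b.eval W S σ = some c ∧ (c = true ↔ b.Holds σ) := by
  induction b with
  | eq e₁ e₂ =>
    exact ⟨_, by simp only [Cond.eval, h.1.eval_eq, h.2.eval_eq]; rfl, by simp [Cond.Holds]⟩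
  | lt e₁ e₂ =>
    exact ⟨_, by simp only [Cond.eval, h.1.eval_eq, h.2.eval_eq]; rfl, by simp [Cond.Holds]⟩
  | not b ih =>
    obtain ⟨c, hc, h'⟩ := ih h
    exact ⟨!c, by simp [Cond.eval, hc], by simp [Cond.Holds, ← h']⟩
  | and b₁ b₂ ih₁ ih₂ =>
    obtain ⟨c₁, hc₁, h₁⟩ := ih₁ h.1
    obtain ⟨c₂, hc₂, h₂⟩ := ih₂ h.2
    exact ⟨c₁ && c₂, by simp [Cond.eval, hc₁, hc₂], by simp [Cond.Holds, ← h₁, ← h₂]⟩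

theorem Cond.Fits.eval_eq_true {W S : ℕ} {σ : Memory} {b : Cond} (h : b.Fits W S σ)
    (hb : b.Holds σ) : b.eval W S σ = some true := by
  obtain ⟨c, hc, h'⟩ := h.exists_eval_eq
  rw [hc, h'.2 hb]

theorem Cond.Fits.eval_eq_false {W S : ℕ} {σ : Memory} {b : Cond} (h : b.Fits W S σ)
    (hb : ¬ b.Holds σ) : b.eval W S σ = some false := by
  obtain ⟨c, hc, h'⟩ := h.exists_eval_eq
  rw [hc, Bool.eq_false_iff.2 (mt h'.1 hb)]

/-- The program halts, and its step count and final memory satisfy `Q`. -/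
def Ensures (W S : ℕ) (p : Program) (σ : Memory) (Q : ℕ → Memory → Prop) : Prop :=
  ∃ t τ, Run W S p σ t τ ∧ Q t τ

section
variable {W S : ℕ} {σ : Memory} {p q : Program} {b : Cond} {Q Q' : ℕ → Memory → Prop}

theorem Ensures.mono (h : Ensures W S p σ Q') (hQ : ∀ t τ, Q' t τ → Q t τ) :
    Ensures W S p σ Q :=
  let ⟨t, τ, hr, hq⟩ := h
  ⟨t, τ, hr, hQ t τ hq⟩

theorem ensures_assign {x : ℕ} {e : Expr} (he : e.Fits W S σ)
    (hQ : Q (e.cost + 1) (σ.setReg x (e.val σ))) : Ensures W S (.assign x e) σ Q :=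
  ⟨_, _, .assign he.eval_eq, hQ⟩

theorem ensures_store {a : ℕ} {i e : Expr} (hi : i.Fits W S σ) (hk : i.val σ < S)
    (he : e.Fits W S σ) (hQ : Q (i.cost + e.cost + 1) (σ.setArr a (i.val σ) (e.val σ))) :
    Ensures W S (.store a i e) σ Q :=
  ⟨_, _, .store hi.eval_eq hk he.eval_eq, hQ⟩

theorem ensures_seq (h : Ensures W S p σ fun t τ => Ensures W S q τ fun t' => Q (t + t')) :
    Ensures W S (.seq p q) σ Q :=
  let ⟨_, _, hr, _, _, hr', hq⟩ := h
  ⟨_, _, .seq hr hr', hq⟩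

theorem ensures_skip (hQ : Q 1 σ) : Ensures W S .skip σ Q := ⟨_, _, .skip σ, hQ⟩

theorem ensures_ite (hb : b.Fits W S σ)
    (hp : b.Holds σ → Ensures W S p σ fun t => Q (b.cost + 1 + t))
    (hq : ¬ b.Holds σ → Ensures W S q σ fun t => Q (b.cost + 1 + t)) :
    Ensures W S (.ite b p q) σ Q := by
  by_cases h : b.Holds σ
  · obtain ⟨t, τ, hr, hQ⟩ := hp h
    exact ⟨_, _, .ite_true (hb.eval_eq_true h) hr, hQ⟩
  · obtain ⟨t, τ, hr, hQ⟩ := hq h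
    exact ⟨_, _, .ite_false (hb.eval_eq_false h) hr, hQ⟩

/-- The rule for loops: every round of the loop is paid for by the credit `μ`. -/
theorem ensures_while (I : Memory → Prop) (μ : Memory → ℕ)
    (hb : ∀ σ, I σ → b.Fits W S σ)
    (hp : ∀ σ, I σ → b.Holds σ →
      Ensures W S p σ fun t τ => I τ ∧ t + (b.cost + 1) + μ τ ≤ μ σ)
    (hσ : I σ) :
    Ensures W S (.while b p) σ
      fun t τ => I τ ∧ ¬ b.Holds τ ∧ t + μ τ ≤ μ σ + (b.cost + 1) := by
  -- Each round consumes a positive amount of credit, so the credit also serves as the termination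
  -- measure.
  induction hk : μ σ using Nat.strong_induction_on generalizing σ with
  | _ k ih =>
    subst hk
    by_cases h : b.Holds σ
    · obtain ⟨t, τ, hr, hI, ht⟩ := hp σ hσ h
      obtain ⟨t', τ', hr', hI', hb', ht'⟩ := ih (μ τ) (by omega) hI rfl
      exact ⟨_, _, .while_true ((hb σ hσ).eval_eq_true h) hr hr', hI', hb', by omega⟩
    · exact ⟨_, _, .while_false ((hb σ hσ).eval_eq_false h), hσ, h, by omega⟩

end

end RAM

/-! ## Bottleneck trees -/

/-- Promotion and nesting change the data of two vertices only. The additive form compares sums over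
all vertices without truncated subtraction. -/
theorem Finset.sum_add_of_eqOn_compl_pair {V : Finset ℕ} {f g : ℕ → ℕ} {x y : ℕ} (hx : x ∈ V)
    (hy : y ∈ V) (hxy : x ≠ y) (h : ∀ t, t ≠ x → t ≠ y → f t = g t) :
    ∑ t ∈ V, f t + (g x + g y) = ∑ t ∈ V, g t + (f x + f y) := by
  have hy' : y ∈ V.erase x := mem_erase.2 ⟨hxy.symm, hy⟩
  rw [← add_sum_erase V f hx, ← add_sum_erase V g hx, ← add_sum_erase _ f hy',
    ← add_sum_erase _ g hy', sum_congr rfl fun t ht => h t (by grind) (by grind)]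
  ring

/-- A tree with root `0`: the parent `p x` of a vertex `x ≠ 0`, the weight `w x` of the edge from
`x` to its parent, and the number `s x` of proper descendants of `x`. -/
structure BottleneckTree where
  p : ℕ → ℕ
  w : ℕ → ℕ
  s : ℕ → ℕ

namespace BottleneckTree

/-- The vertices other than the root are `1, …, N`, and the weights are at most `B`. -/
structure WF (N B : ℕ) (T : BottleneckTree) : Prop where
  p_le : ∀ x ∈ Finset.Icc 1 N, T.p x ≤ N
  w_le : ∀ x ∈ Finset.Icc 1 N, T.w x ≤ B
  s_lt : ∀ x ∈ Finset.Icc 1 N, T.s x < N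
  -- This recursion also excludes cycles: sizes increase strictly from child to parent. Nothing is
  -- required of the cells of the root.
  s_eq : ∀ x ∈ Finset.Icc 1 N,
    T.s x = ∑ y ∈ Finset.Icc 1 N, if T.p y = x then T.s y + 1 else 0

/-- Connection by edges of weight at least `θ`. -/
def rel (N : ℕ) (T : BottleneckTree) (θ : ℕ) : Setoid ℕ :=
  Relation.EqvGen.setoid fun x y => x ∈ Finset.Icc 1 N ∧ θ ≤ T.w x ∧ y = T.p x

/-- The number of edges of weight at least `θ`. -/
def heavyCount (N : ℕ) (T : BottleneckTree) (θ : ℕ) : ℕ :=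
  ∑ x ∈ Finset.Icc 1 N, if θ ≤ T.w x then 1 else 0

/-- The potential for the amortized analysis. -/
def potential (N : ℕ) (T : BottleneckTree) : ℕ :=
  ∑ x ∈ Finset.Icc 1 N, Nat.log 2 (T.s x + 1)

/-- Meant for an edge above `x` that is not heavier than the edge above its parent: `x` then reaches
the grandparent with bottleneck `T.w x`. The old parent loses a subtree of `T.s x + 1` vertices. -/
def shortcut (T : BottleneckTree) (x : ℕ) : BottleneckTree where
  p := Function.update T.p x (T.p (T.p x))
  w := T.w
  s := Function.update T.s (T.p x) (T.s (T.p x) - (T.s x + 1))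

/-- Meant for an edge above `x` that is heavier than the edge above its parent: the heavy edge is
reversed, and `x` takes over the lighter edge to the grandparent together with the size of the
parent. -/
def rotate (T : BottleneckTree) (x : ℕ) : BottleneckTree where
  p := Function.update (Function.update T.p (T.p x) x) x (T.p (T.p x))
  w := Function.update (Function.update T.w x (T.w (T.p x))) (T.p x) (T.w x)
  s := Function.update (Function.update T.s (T.p x) (T.s (T.p x) - (T.s x + 1))) x (T.s (T.p x))

/-- Decrease the depth of `x` by one, without changing the connections. -/
def promote (T : BottleneckTree) (x : ℕ) : BottleneckTree :=
  if T.w (T.p x) < T.w x then T.rotate x else T.shortcut x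

variable {N B : ℕ} {T : BottleneckTree} {x : ℕ}

/-! ### Sizes along the tree, and promotion of well-formed trees. -/

theorem WF.p_mem (h : T.WF N B) (hx : x ∈ Finset.Icc 1 N) (h0 : T.p x ≠ 0) :
    T.p x ∈ Finset.Icc 1 N :=
  Finset.mem_Icc.2 ⟨by omega, h.p_le x hx⟩

theorem WF.s_lt_parent (h : T.WF N B) (hx : x ∈ Finset.Icc 1 N) (h0 : T.p x ≠ 0) :
    T.s x < T.s (T.p x) := by
  rw [h.s_eq _ (h.p_mem hx h0)]
  have := Finset.single_le_sum (f := fun y => if T.p y = T.p x then T.s y + 1 else 0)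
    (fun _ _ => Nat.zero_le _) hx
  simp only [if_true] at this
  omega

theorem WF.p_ne (h : T.WF N B) (hx : x ∈ Finset.Icc 1 N) : T.p x ≠ x := by
  intro h'
  have h0 : T.p x ≠ 0 := by rw [h']; exact (by have := (Finset.mem_Icc.1 hx).1; omega)
  have := h.s_lt_parent hx h0
  rw [h'] at this
  omega

theorem WF.p_p_ne (h : T.WF N B) (hx : x ∈ Finset.Icc 1 N) (h0 : T.p x ≠ 0) :
    T.p (T.p x) ≠ x := by
  intro h'
  have := h.s_lt_parent hx h0
  have := h.s_lt_parent (h.p_mem hx h0) (by rw [h']; have := (Finset.mem_Icc.1 hx).1; omega)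
  rw [h'] at this
  omega

theorem WF.shortcut (h : T.WF N B) (hx : x ∈ Finset.Icc 1 N) (h0 : T.p x ≠ 0) :
    (T.shortcut x).WF N B := by
  have hy := h.p_mem hx h0
  have hyx := h.p_ne hx
  have hzx := h.p_p_ne hx h0
  have hzy := h.p_ne hy
  have hs := h.s_lt_parent hx h0
  refine ⟨fun t ht => ?_, h.w_le, fun t ht => ?_, fun t ht => ?_⟩
  · have := h.p_le t ht
    have := h.p_le _ hy
    simp only [BottleneckTree.shortcut, Function.update_apply]
    split_ifs <;> omega
  · have := h.s_lt t ht
    have := h.s_lt _ hy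
    simp only [BottleneckTree.shortcut, Function.update_apply]
    split_ifs <;> omega
  · have h1 := h.s_eq t ht
    -- Only the summands of `x` and its parent differ, so the recursion at `t` reduces to cases by
    -- whether `t` is `x`, its parent, its grandparent or none of them.
    have h2 := Finset.sum_add_of_eqOn_compl_pair
      (f := fun y => if (T.shortcut x).p y = t then (T.shortcut x).s y + 1 else 0)
      (g := fun y => if T.p y = t then T.s y + 1 else 0) hx hy hyx.symm
      (fun u hu hu' => by simp [BottleneckTree.shortcut, hu, hu'])
    simp only [BottleneckTree.shortcut, Function.update_apply] at h2 ⊢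
    grind

theorem WF.rotate (h : T.WF N B) (hx : x ∈ Finset.Icc 1 N) (h0 : T.p x ≠ 0) :
    (T.rotate x).WF N B := by
  have hy := h.p_mem hx h0
  have hyx := h.p_ne hx
  have hzx := h.p_p_ne hx h0
  have hzy := h.p_ne hy
  have hs := h.s_lt_parent hx h0
  refine ⟨fun t ht => ?_, fun t ht => ?_, fun t ht => ?_, fun t ht => ?_⟩
  · have := h.p_le t ht
    have := h.p_le _ hy
    have := (Finset.mem_Icc.1 hx).2
    simp only [BottleneckTree.rotate, Function.update_apply]
    split_ifs <;> omega
  · have := h.w_le t ht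
    have := h.w_le _ hy
    have := h.w_le _ hx
    simp only [BottleneckTree.rotate, Function.update_apply]
    split_ifs <;> omega
  · have := h.s_lt t ht
    have := h.s_lt _ hy
    simp only [BottleneckTree.rotate, Function.update_apply]
    split_ifs <;> omega
  · have h1 := h.s_eq t ht
    have h2 := Finset.sum_add_of_eqOn_compl_pair
      (f := fun y => if (T.rotate x).p y = t then (T.rotate x).s y + 1 else 0)
      (g := fun y => if T.p y = t then T.s y + 1 else 0) hx hy hyx.symm
      (fun u hu hu' => by simp [BottleneckTree.rotate, hu, hu'])
    simp only [BottleneckTree.rotate, Function.update_apply] at h2 ⊢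
    grind

theorem WF.promote (h : T.WF N B) (hx : x ∈ Finset.Icc 1 N) (h0 : T.p x ≠ 0) :
    (T.promote x).WF N B := by
  unfold BottleneckTree.promote
  split_ifs
  exacts [h.rotate hx h0, h.shortcut hx h0]

/-! ### Promotion preserves the connections at every threshold. -/

theorem rel_p {θ : ℕ} (hx : x ∈ Finset.Icc 1 N) (hw : θ ≤ T.w x) : T.rel N θ x (T.p x) :=
  .rel _ _ ⟨hx, hw, rfl⟩

theorem rel_le {θ : ℕ} {r : Setoid ℕ} (h : ∀ x ∈ Finset.Icc 1 N, θ ≤ T.w x → r x (T.p x)) :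
    T.rel N θ ≤ r :=
  Setoid.eqvGen_le (by rintro x _ ⟨hx, hw, rfl⟩; exact h x hx hw)

/-- Whenever the edge above `x` is heavy enough, so is the one above its parent. Then `x`, its
parent and its grandparent lie in one class both before and after the change. -/
theorem WF.rel_shortcut (h : T.WF N B) (hx : x ∈ Finset.Icc 1 N) (h0 : T.p x ≠ 0)
    (hw : T.w x ≤ T.w (T.p x)) (θ : ℕ) : (T.shortcut x).rel N θ = T.rel N θ := by
  have hy := h.p_mem hx h0
  have hyx := h.p_ne hx
  apply le_antisymm
  · refine rel_le fun t ht hθ => ?_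
    by_cases htx : t = x
    · subst htx
      have : (T.shortcut t).p t = T.p (T.p t) := by simp [BottleneckTree.shortcut]
      rw [this]
      exact (T.rel N θ).trans' (rel_p hx hθ) (rel_p hy (le_trans hθ hw))
    · have : (T.shortcut x).p t = T.p t := by simp [BottleneckTree.shortcut, htx]
      rw [this]
      exact rel_p ht hθ
  · have key : ∀ t ∈ Finset.Icc 1 N, t ≠ x → θ ≤ T.w t →
        (T.shortcut x).rel N θ t (T.p t) := fun t ht htx hθ => by
      have := rel_p (T := T.shortcut x) ht hθ
      rwa [show (T.shortcut x).p t = T.p t by simp [BottleneckTree.shortcut, htx]] at this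
    refine rel_le fun t ht hθ => ?_
    by_cases htx : t = x
    · subst htx
      have h1 := rel_p (T := T.shortcut t) hx hθ
      rw [show (T.shortcut t).p t = T.p (T.p t) by simp [BottleneckTree.shortcut]] at h1
      exact Setoid.trans' _ h1 (Setoid.symm' _ (key _ hy hyx (hθ.trans hw)))
    · exact key t ht htx hθ

/-- The edge between `x` and its parent survives with its weight. The light edge to the grandparent
moves from one of its ends to the other, and whenever it counts, the heavier edge between these ends
counts as well. -/
theorem WF.rel_rotate (h : T.WF N B) (hx : x ∈ Finset.Icc 1 N) (h0 : T.p x ≠ 0)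
    (hw : T.w (T.p x) < T.w x) (θ : ℕ) : (T.rotate x).rel N θ = T.rel N θ := by
  have hy := h.p_mem hx h0
  have hyx := h.p_ne hx
  have e1 : (T.rotate x).p x = T.p (T.p x) := by simp [BottleneckTree.rotate]
  have e2 : (T.rotate x).p (T.p x) = x := by simp [BottleneckTree.rotate, hyx]
  have e3 : (T.rotate x).w x = T.w (T.p x) := by simp [BottleneckTree.rotate, hyx.symm]
  have e4 : (T.rotate x).w (T.p x) = T.w x := by simp [BottleneckTree.rotate]
  have e5 : ∀ t, t ≠ x → t ≠ T.p x → (T.rotate x).p t = T.p t := fun t h h' => by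
    simp [BottleneckTree.rotate, h, h']
  have e6 : ∀ t, t ≠ x → t ≠ T.p x → (T.rotate x).w t = T.w t := fun t h h' => by
    simp [BottleneckTree.rotate, h, h']
  apply le_antisymm
  · refine rel_le fun t ht hθ => ?_
    by_cases htx : t = x
    · subst htx
      rw [e3] at hθ
      rw [e1]
      exact Setoid.trans' _ (rel_p hx (by omega)) (rel_p hy hθ)
    by_cases hty : t = T.p x
    · subst hty
      rw [e4] at hθ
      rw [e2]
      exact Setoid.symm' _ (rel_p hx hθ)
    rw [e6 t htx hty] at hθ
    rw [e5 t htx hty]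
    exact rel_p ht hθ
  · have hyx' : θ ≤ T.w x → (T.rotate x).rel N θ x (T.p x) := fun hθ => by
      have := rel_p (T := T.rotate x) hy (e4.symm ▸ hθ)
      rw [e2] at this
      exact Setoid.symm' _ this
    refine rel_le fun t ht hθ => ?_
    by_cases htx : t = x
    · subst htx
      exact hyx' hθ
    by_cases hty : t = T.p x
    · subst hty
      have := rel_p (T := T.rotate x) hx (e3.symm ▸ hθ)
      rw [e1] at this
      exact Setoid.trans' _ (Setoid.symm' _ (hyx' (by omega))) this
    have := rel_p (T := T.rotate x) ht ((e6 t htx hty).symm ▸ hθ)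
    rwa [e5 t htx hty] at this

theorem WF.rel_promote (h : T.WF N B) (hx : x ∈ Finset.Icc 1 N) (h0 : T.p x ≠ 0) (θ : ℕ) :
    (T.promote x).rel N θ = T.rel N θ := by
  unfold BottleneckTree.promote
  split_ifs with hw
  exacts [h.rel_rotate hx h0 hw θ, h.rel_shortcut hx h0 (not_lt.1 hw) θ]

theorem WF.heavyCount_promote (h : T.WF N B) (hx : x ∈ Finset.Icc 1 N) (h0 : T.p x ≠ 0) (θ : ℕ) :
    (T.promote x).heavyCount N θ = T.heavyCount N θ := by
  unfold BottleneckTree.promote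
  split_ifs with hw
  · have hyx := h.p_ne hx
    have := Finset.sum_add_of_eqOn_compl_pair
      (f := fun y => if θ ≤ (T.rotate x).w y then 1 else 0)
      (g := fun y => if θ ≤ T.w y then 1 else 0) hx (h.p_mem hx h0) hyx.symm
      (fun u hu hu' => by simp [BottleneckTree.rotate, hu, hu'])
    simp only [heavyCount]
    simp only [BottleneckTree.rotate, Function.update_apply] at this ⊢
    grind
  · rfl

/-! ### Amortized analysis of promotions. -/

/-- In both cases the old parent only loses vertices, so the potential grows by at most the growth
of the term of `x`. After a rotation the new term of `x` is the old term of its parent. -/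
theorem WF.potential_promote (h : T.WF N B) (hx : x ∈ Finset.Icc 1 N) (h0 : T.p x ≠ 0) :
    (T.promote x).potential N + Nat.log 2 (T.s x + 1) ≤
      T.potential N + Nat.log 2 ((T.promote x).s x + 1) := by
  have hyx := h.p_ne hx
  have hs := h.s_lt_parent hx h0
  have hl : Nat.log 2 (T.s (T.p x) - (T.s x + 1) + 1) ≤ Nat.log 2 (T.s (T.p x) + 1) :=
    Nat.log_mono_right (by omega)
  unfold BottleneckTree.promote
  split_ifs with hw
  · have := Finset.sum_add_of_eqOn_compl_pair
      (f := fun y => Nat.log 2 ((T.rotate x).s y + 1))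
      (g := fun y => Nat.log 2 (T.s y + 1)) hx (h.p_mem hx h0) hyx.symm
      (fun u hu hu' => by simp [BottleneckTree.rotate, hu, hu'])
    simp only [potential]
    simp only [BottleneckTree.rotate, Function.update_apply, if_true, if_neg hyx] at this ⊢
    omega
  · have := Finset.sum_add_of_eqOn_compl_pair
      (f := fun y => Nat.log 2 ((T.shortcut x).s y + 1))
      (g := fun y => Nat.log 2 (T.s y + 1)) hx (h.p_mem hx h0) hyx.symm
      (fun u hu hu' => by simp [BottleneckTree.shortcut, hu'])
    simp only [potential]
    simp only [BottleneckTree.shortcut, Function.update_apply, if_true, if_neg hyx.symm] at this ⊢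
    omega

theorem log_two_add_one_le {a b : ℕ} (ha : 0 < a) (h : 2 * a ≤ b) :
    Nat.log 2 a + 1 ≤ Nat.log 2 b := by
  rw [← Nat.log_mul_base one_lt_two ha.ne']
  exact Nat.log_mono_right (by omega)

/-- If the subtree of `x` has at least two thirds of the vertices below its parent, the old parent
keeps at most half as many as `x` had. Its logarithm ends at least one below the old logarithm of
`x`, which was at most that of the parent. -/
theorem WF.potential_promote_lt (h : T.WF N B) (hx : x ∈ Finset.Icc 1 N) (h0 : T.p x ≠ 0)
    (hs' : 2 * (T.s (T.p x) + 1) ≤ 3 * (T.s x + 1)) :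
    (T.promote x).potential N < T.potential N := by
  have hyx := h.p_ne hx
  have hs := h.s_lt_parent hx h0
  have hl : Nat.log 2 (T.s (T.p x) - (T.s x + 1) + 1) + 1 ≤ Nat.log 2 (T.s x + 1) :=
    log_two_add_one_le (by omega) (by omega)
  have hl' : Nat.log 2 (T.s x + 1) ≤ Nat.log 2 (T.s (T.p x) + 1) :=
    Nat.log_mono_right (by omega)
  unfold BottleneckTree.promote
  split_ifs with hw
  · have := Finset.sum_add_of_eqOn_compl_pair
      (f := fun y => Nat.log 2 ((T.rotate x).s y + 1))
      (g := fun y => Nat.log 2 (T.s y + 1)) hx (h.p_mem hx h0) hyx.symm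
      (fun u hu hu' => by simp [BottleneckTree.rotate, hu, hu'])
    simp only [potential]
    simp only [BottleneckTree.rotate, Function.update_apply, if_true, if_neg hyx] at this ⊢
    omega
  · have := Finset.sum_add_of_eqOn_compl_pair
      (f := fun y => Nat.log 2 ((T.shortcut x).s y + 1))
      (g := fun y => Nat.log 2 (T.s y + 1)) hx (h.p_mem hx h0) hyx.symm
      (fun u hu hu' => by simp [BottleneckTree.shortcut, hu'])
    simp only [potential]
    simp only [BottleneckTree.shortcut, Function.update_apply, if_true, if_neg hyx.symm] at this ⊢
    omega

theorem promote_p_self (T : BottleneckTree) (x : ℕ) : (T.promote x).p x = T.p (T.p x) := by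
  unfold BottleneckTree.promote
  split_ifs <;> simp [rotate, shortcut]

theorem promote_p_of_ne (T : BottleneckTree) {x t : ℕ} (h : t ≠ x) (h' : t ≠ T.p x) :
    (T.promote x).p t = T.p t := by
  unfold BottleneckTree.promote
  split_ifs <;> simp [rotate, shortcut, h, h']

theorem promote_s_of_ne (T : BottleneckTree) {x t : ℕ} (h : t ≠ x) (h' : t ≠ T.p x) :
    (T.promote x).s t = T.s t := by
  unfold BottleneckTree.promote
  split_ifs <;> simp [rotate, shortcut, h, h']

theorem WF.le_promote_s (h : T.WF N B) (hx : x ∈ Finset.Icc 1 N) (h0 : T.p x ≠ 0) :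
    T.s x ≤ (T.promote x).s x := by
  have hyx := h.p_ne hx
  have hs := h.s_lt_parent hx h0
  unfold BottleneckTree.promote
  split_ifs
  · simpa [BottleneckTree.rotate] using hs.le
  · simp [BottleneckTree.shortcut, hyx.symm]

/-- The vertex to be promoted next in order to bring `u` to the top: the parent of `u`, if the edge
above it joins subtrees of similar sizes and does not end in a child of the root, and `u`
otherwise. -/
def nextPromoted (T : BottleneckTree) (u : ℕ) : ℕ :=
  if T.p (T.p u) ≠ 0 ∧ T.p (T.p (T.p u)) ≠ 0 ∧
    2 * (T.s (T.p (T.p u)) + 1) ≤ 3 * (T.s (T.p u) + 1) then T.p u else u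

/-- A bound for the number of promotions that bring `u` to the top. -/
def credit (N : ℕ) (T : BottleneckTree) (u : ℕ) : ℕ :=
  T.potential N +
    -- The summand is `0` and `1` at the two highest levels; deeper down it decreases with the size
    -- of the parent. The square is there because a growth by the factor `3/2` raises the integer
    -- logarithm by one only after squaring.
    (if T.p u = 0 then 0 else if T.p (T.p u) = 0 then 1 else
      2 * Nat.log 2 N + 3 - Nat.log 2 ((T.s (T.p u) + 1) ^ 2)) -
    Nat.log 2 (T.s u + 1)

/-- This keeps the subtraction inside `credit` from truncating and leaves at least `2`, more than
the value `1` used one level higher. -/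
theorem WF.log_sq_le (h : T.WF N B) (hx : x ∈ Finset.Icc 1 N) :
    Nat.log 2 ((T.s x + 1) ^ 2) ≤ 2 * Nat.log 2 N + 1 := by
  have h1 : T.s x + 1 < 2 ^ (Nat.log 2 N + 1) :=
    lt_of_le_of_lt (h.s_lt x hx) (Nat.lt_pow_succ_log_self one_lt_two N)
  have h2 : (T.s x + 1) ^ 2 < 2 ^ (2 * Nat.log 2 N + 2) := by
    calc (T.s x + 1) ^ 2 < (2 ^ (Nat.log 2 N + 1)) ^ 2 := Nat.pow_lt_pow_left h1 two_ne_zero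
      _ = _ := by rw [← pow_mul]; congr 1; ring
  exact Nat.lt_succ_iff.1 (Nat.log_lt_of_lt_pow (by positivity) h2)

theorem log_le_potential (T : BottleneckTree) (hx : x ∈ Finset.Icc 1 N) :
    Nat.log 2 (T.s x + 1) ≤ T.potential N :=
  Finset.single_le_sum (f := fun x => Nat.log 2 (T.s x + 1)) (fun _ _ => Nat.zero_le _) hx

variable {u : ℕ}

theorem WF.nextPromoted_mem (h : T.WF N B) (hu : u ∈ Finset.Icc 1 N) (h0 : T.p u ≠ 0) :
    T.nextPromoted u ∈ Finset.Icc 1 N ∧ T.p (T.nextPromoted u) ≠ 0 := by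
  unfold nextPromoted
  split_ifs with hc
  exacts [⟨h.p_mem hu h0, hc.1⟩, ⟨hu, h0⟩]

/-- If the parent of `u` is promoted, the potential itself drops, and the size of the parent does
not decrease. If `u` is promoted, the potential minus the logarithm of `u` does not grow, and the
middle summand of `credit` drops: the new parent of `u` has a subtree more than `3/2` times as
large, or `u` enters one of the two highest levels. -/
theorem WF.credit_promote_lt (h : T.WF N B) (hu : u ∈ Finset.Icc 1 N) (h0 : T.p u ≠ 0) :
    (T.promote (T.nextPromoted u)).credit N u < T.credit N u := by
  have hy := h.p_mem hu h0
  have hyu := h.p_ne hu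
  have hzu := h.p_p_ne hu h0
  have hzy := h.p_ne hy
  have hlog := h.log_sq_le hy
  have hpot := log_le_potential T hu
  unfold nextPromoted
  split_ifs with hc
  · obtain ⟨hz0, hz1, hc⟩ := hc
    have h1 := promote_p_of_ne T (x := T.p u) hyu.symm hzu.symm
    have h1' := promote_p_self T (T.p u)
    have h2 := promote_s_of_ne T (x := T.p u) hyu.symm hzu.symm
    have h3 := h.le_promote_s hy hz0
    have h4 := h.potential_promote_lt hy hz0 hc
    have h5 : Nat.log 2 ((T.s (T.p u) + 1) ^ 2) ≤
        Nat.log 2 (((T.promote (T.p u)).s (T.p u) + 1) ^ 2) :=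
      Nat.log_mono_right (Nat.pow_le_pow_left (by omega) 2)
    simp only [credit, h1, h1', h2, if_neg h0, if_neg hz0, if_neg hz1]
    omega
  · have h1 := promote_p_self T u
    have h4 := h.potential_promote hu h0
    have h6 := log_le_potential (T.promote u) hu
    simp only [credit, h1, if_neg h0]
    by_cases hz0 : T.p (T.p u) = 0
    · rw [if_pos hz0, if_pos hz0]
      omega
    have h2 := promote_p_of_ne T (x := u) hzu hzy
    rw [if_neg hz0, if_neg hz0, h2]
    by_cases hz1 : T.p (T.p (T.p u)) = 0
    · rw [if_pos hz1]
      omega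
    · have hc' : 3 * (T.s (T.p u) + 1) < 2 * (T.s (T.p (T.p u)) + 1) := by
        by_contra hcon
        exact hc ⟨hz0, hz1, by omega⟩
      have h2 := promote_s_of_ne T (x := u) hzu hzy
      have h5 : Nat.log 2 ((T.s (T.p u) + 1) ^ 2) + 1 ≤
          Nat.log 2 ((T.s (T.p (T.p u)) + 1) ^ 2) :=
        -- The ratio exceeds `3/2`, and `(3/2)² = 9/4 > 2`.
        log_two_add_one_le (by positivity) (by nlinarith)
      rw [if_neg hz1, h2]
      omega

/-- A child `o` of the root can lose this position only as the parent of the promoted vertex. The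
guards in `nextPromoted` leave only `u` for that vertex, and `u` then takes the place of `o`. This
keeps the first end of an edge within reach while the second one is lifted. -/
theorem p_promote_eq_zero_or (T : BottleneckTree) {u o : ℕ} (h0 : T.p u ≠ 0) (ho : T.p o = 0) :
    (T.promote (T.nextPromoted u)).p o = 0 ∨
      (T.promote (T.nextPromoted u)).p o = u ∧ (T.promote (T.nextPromoted u)).p u = 0 := by
  unfold nextPromoted
  split_ifs with hc
  · left
    rw [promote_p_of_ne, ho]
    · rintro rfl
      exact hc.1 ho
    · rintro rfl
      exact hc.2.1 ho
  · by_cases hou : o = T.p u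
    · subst hou
      rw [promote_p_self, ho]
      unfold BottleneckTree.promote
      by_cases hpu : T.p u = u
      · rw [hpu] at ho
        exact absurd ho h0
      · split_ifs <;> simp [rotate, shortcut, ho, hpu]
    · left
      rw [promote_p_of_ne T _ hou, ho]
      rintro rfl
      exact h0 ho

theorem credit_le (T : BottleneckTree) (u : ℕ) :
    T.credit N u ≤ T.potential N + 2 * Nat.log 2 N + 3 := by
  unfold credit
  split_ifs <;> omega

theorem WF.potential_le_credit (h : T.WF N B) (hu : u ∈ Finset.Icc 1 N) :
    T.potential N ≤ T.credit N u + Nat.log 2 N := by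
  have : Nat.log 2 (T.s u + 1) ≤ Nat.log 2 N := Nat.log_mono_right (h.s_lt u hu)
  unfold credit
  omega

/-! ### The classes of the connection relation -/

/-- Follow the edges of weight at least `θ`. -/
def climb (N : ℕ) (T : BottleneckTree) (θ x : ℕ) : ℕ :=
  if x ∈ Finset.Icc 1 N ∧ θ ≤ T.w x then T.p x else x

/-- The top of the class of `x`. -/
def top (N : ℕ) (T : BottleneckTree) (θ x : ℕ) : ℕ := (T.climb N θ)^[N] x

theorem rel_climb (T : BottleneckTree) (θ x : ℕ) : T.rel N θ x (T.climb N θ x) := by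
  unfold climb
  split_ifs with h'
  exacts [rel_p h'.1 h'.2, Setoid.refl' _ _]

theorem rel_top (T : BottleneckTree) (θ x : ℕ) : T.rel N θ x (T.top N θ x) := by
  unfold top
  exact Function.Iterate.rec (fun y => T.rel N θ x y) (Setoid.refl' _ _)
    (fun y hy => Setoid.trans' _ hy (rel_climb T θ y)) N

/-- Every climb along a heavy edge increases the size by at least one. As sizes stay below `N`,
after `N` steps the climb has ended at the root or below a light edge. -/
theorem climb_iterate_eq_zero_or (h : T.WF N B) (θ : ℕ) (hx : x ∈ Finset.Icc 1 N) (k : ℕ) :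
    (T.climb N θ)^[k] x = 0 ∨ (T.climb N θ)^[k] x ∈ Finset.Icc 1 N ∧
      T.s x ≤ T.s ((T.climb N θ)^[k] x) ∧
      (T.w ((T.climb N θ)^[k] x) < θ ∨ k ≤ T.s ((T.climb N θ)^[k] x)) := by
  induction k with
  | zero => exact .inr ⟨hx, le_rfl, .inr (Nat.zero_le _)⟩
  | succ k ih =>
    rw [Function.iterate_succ_apply']
    generalize (T.climb N θ)^[k] x = y at ih
    rcases ih with rfl | ⟨hy, h1, h2⟩
    · exact .inl (by simp [climb])
    · by_cases hw : θ ≤ T.w y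
      · have hc : T.climb N θ y = T.p y := if_pos ⟨hy, hw⟩
        rw [hc]
        by_cases h0 : T.p y = 0
        · exact .inl h0
        · have := h.s_lt_parent hy h0
          exact .inr ⟨h.p_mem hy h0, by omega, .inr (by omega)⟩
      · have hc : T.climb N θ y = y := if_neg fun h' => hw h'.2
        rw [hc]
        exact .inr ⟨hy, h1, .inl (by omega)⟩

theorem top_eq_zero_or (h : T.WF N B) (θ : ℕ) (hx : x ∈ Finset.Icc 1 N) :
    T.top N θ x = 0 ∨ T.top N θ x ∈ Finset.Icc 1 N ∧ T.s x ≤ T.s (T.top N θ x) ∧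
      T.w (T.top N θ x) < θ := by
  refine (climb_iterate_eq_zero_or h θ hx N).imp_right fun h' => ⟨h'.1, h'.2.1, ?_⟩
  have := h.s_lt _ h'.1
  unfold top
  omega

theorem climb_top (h : T.WF N B) (θ : ℕ) (hx : x ∈ Finset.Icc 1 N) :
    T.climb N θ (T.top N θ x) = T.top N θ x := by
  rcases top_eq_zero_or h θ hx with h' | h'
  · rw [h']
    simp [climb]
  · exact if_neg fun h'' => by omega

theorem top_of_lt (T : BottleneckTree) {θ : ℕ} (hw : T.w x < θ) : T.top N θ x = x := by
  unfold top
  exact Function.iterate_fixed (f := T.climb N θ) (if_neg (fun h => by omega)) N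

theorem top_zero (T : BottleneckTree) (θ : ℕ) : T.top N θ 0 = 0 := by
  unfold top
  exact Function.iterate_fixed (f := T.climb N θ) (if_neg (fun h => by simp at h)) N

theorem rel_iff_top_eq (h : T.WF N B) {θ x y : ℕ} :
    T.rel N θ x y ↔ T.top N θ x = T.top N θ y := by
  constructor
  · intro hxy
    -- The top is a fixed point of `climb`, so it does not change along a generating edge.
    have : T.rel N θ ≤ Setoid.ker (T.top N θ) := rel_le fun t ht hw => by
      have hc : T.climb N θ t = T.p t := if_pos ⟨ht, hw⟩
      rw [Setoid.ker_def, ← hc]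
      have := climb_top h θ ht
      unfold top at this ⊢
      rw [← Function.iterate_succ_apply, Function.iterate_succ_apply', this]
    exact this hxy
  · intro hxy
    have := rel_top (N := N) T θ x
    rw [hxy] at this
    exact Setoid.trans' _ this (Setoid.symm' _ (rel_top T θ y))

/-- If the edge above `x` is lighter than `θ`, then `x` is its own top, whereas the top of its
parent is the root or a vertex of larger size. So the bottleneck between `x` and its parent is
exactly `T.w x`. -/
theorem WF.rel_p_iff (h : T.WF N B) (hx : x ∈ Finset.Icc 1 N) {θ : ℕ} :
    T.rel N θ x (T.p x) ↔ θ ≤ T.w x := by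
  refine ⟨fun h' => ?_, rel_p hx⟩
  by_contra hw
  have hx1 := (Finset.mem_Icc.1 hx).1
  rw [rel_iff_top_eq h, top_of_lt T (by omega)] at h'
  by_cases h0 : T.p x = 0
  · rw [h0, top_zero] at h'
    omega
  · have h1 := h.s_lt_parent hx h0
    rcases top_eq_zero_or h θ (h.p_mem hx h0) with h2 | ⟨-, h2, -⟩
    · omega
    · rw [← h'] at h2
      omega

/-! ### Insertion of edges -/

/-- Make `u` a child of `v`, where both are children of the root. -/
def nest (T : BottleneckTree) (u v : ℕ) : BottleneckTree where
  p := Function.update T.p u v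
  w := T.w
  s := Function.update T.s v (T.s v + T.s u + 1)

/-- Raise the weight of the edge above `u` to at least `c`. -/
def raise (T : BottleneckTree) (u c : ℕ) : BottleneckTree where
  p := T.p
  w := Function.update T.w u (max (T.w u) c)
  s := T.s

/-- The subtrees of the children of the root partition the vertices: summing the recursion for the
sizes over all `x` counts `T.s y + 1` once for each `y` that is not a child of the root. -/
theorem WF.sum_top (h : T.WF N B) :
    ∑ y ∈ Finset.Icc 1 N, (if T.p y = 0 then T.s y + 1 else 0) = N := by
  have h1 : ∑ x ∈ Finset.Icc 1 N, T.s x =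
      ∑ y ∈ Finset.Icc 1 N, (if T.p y = 0 then 0 else T.s y + 1) := by
    rw [Finset.sum_congr rfl h.s_eq, Finset.sum_comm]
    refine Finset.sum_congr rfl fun y hy => ?_
    rw [Finset.sum_ite_eq]
    have := h.p_le y hy
    simp only [Finset.mem_Icc]
    split_ifs <;> first | rfl | omega
  have h2 : ∑ y ∈ Finset.Icc 1 N, (if T.p y = 0 then T.s y + 1 else 0) +
      ∑ y ∈ Finset.Icc 1 N, (if T.p y = 0 then 0 else T.s y + 1) =
      ∑ y ∈ Finset.Icc 1 N, (T.s y + 1) := by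
    rw [← Finset.sum_add_distrib]
    exact Finset.sum_congr rfl fun y _ => by split_ifs <;> simp
  rw [Finset.sum_add_distrib, Finset.sum_const, Nat.card_Icc] at h2
  simp only [smul_eq_mul, mul_one, Nat.add_sub_cancel] at h2
  omega

variable {v : ℕ}

theorem WF.add_le_of_top (h : T.WF N B) (hu : u ∈ Finset.Icc 1 N) (hv : v ∈ Finset.Icc 1 N)
    (huv : u ≠ v) (hpu : T.p u = 0) (hpv : T.p v = 0) : T.s u + T.s v + 2 ≤ N := by
  have h1 := h.sum_top
  rw [← Finset.add_sum_erase _ _ hu, ← Finset.add_sum_erase _ _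
    (Finset.mem_erase.2 ⟨huv.symm, hv⟩), if_pos hpu, if_pos hpv] at h1
  omega

theorem WF.nest (h : T.WF N B) (hu : u ∈ Finset.Icc 1 N) (hv : v ∈ Finset.Icc 1 N)
    (huv : u ≠ v) (hpu : T.p u = 0) (hpv : T.p v = 0) : (T.nest u v).WF N B := by
  have hs := h.add_le_of_top hu hv huv hpu hpv
  have hv' := Finset.mem_Icc.1 hv
  refine ⟨fun t ht => ?_, h.w_le, fun t ht => ?_, fun t ht => ?_⟩
  · have := h.p_le t ht
    simp only [BottleneckTree.nest, Function.update_apply]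
    split_ifs <;> omega
  · have := h.s_lt t ht
    simp only [BottleneckTree.nest, Function.update_apply]
    split_ifs <;> omega
  · have h1 := h.s_eq t ht
    have ht' := Finset.mem_Icc.1 ht
    have h2 := Finset.sum_add_of_eqOn_compl_pair
      (f := fun y => if (T.nest u v).p y = t then (T.nest u v).s y + 1 else 0)
      (g := fun y => if T.p y = t then T.s y + 1 else 0) hu hv huv
      (fun u hu hu' => by simp [BottleneckTree.nest, hu, hu'])
    simp only [BottleneckTree.nest, Function.update_apply] at h2 ⊢
    grind

/-- When the edge above `u` counts, so does the one above `v`, and then `v` is connected to the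
root. Hence at every threshold it makes no difference whether the edge above `u` ends in the root or
in `v`. -/
theorem WF.rel_nest (hu : u ∈ Finset.Icc 1 N) (hv : v ∈ Finset.Icc 1 N)
    (huv : u ≠ v) (hpu : T.p u = 0) (hpv : T.p v = 0) (hw : T.w u ≤ T.w v) (θ : ℕ) :
    (T.nest u v).rel N θ = T.rel N θ := by
  have e1 : (T.nest u v).p u = v := by simp [BottleneckTree.nest]
  have e2 : ∀ t, t ≠ u → (T.nest u v).p t = T.p t := fun t h => by simp [BottleneckTree.nest, h]
  have hv0 : θ ≤ T.w v → T.rel N θ v 0 := fun h => hpv ▸ rel_p hv h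
  have hv0' : θ ≤ T.w v → (T.nest u v).rel N θ v 0 := fun h => by
    have := rel_p (T := T.nest u v) hv h
    rwa [e2 v huv.symm, hpv] at this
  apply le_antisymm
  · refine rel_le fun t ht (hθ : θ ≤ T.w t) => ?_
    by_cases htu : t = u
    · subst htu
      rw [e1]
      exact Setoid.trans' _ (hpu ▸ rel_p hu hθ : T.rel N θ t 0)
        (Setoid.symm' _ (hv0 (hθ.trans hw)))
    · rw [e2 t htu]
      exact rel_p ht hθ
  · refine rel_le fun t ht hθ => ?_
    by_cases htu : t = u
    · subst htu
      have := rel_p (T := T.nest t v) hu hθ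
      rw [e1] at this
      rw [hpu]
      exact Setoid.trans' _ this (hv0' (hθ.trans hw))
    · have := rel_p (T := T.nest u v) ht hθ
      rwa [e2 t htu] at this

theorem WF.potential_nest_le (h : T.WF N B) (hu : u ∈ Finset.Icc 1 N) (hv : v ∈ Finset.Icc 1 N)
    (huv : u ≠ v) (hpu : T.p u = 0) (hpv : T.p v = 0) :
    (T.nest u v).potential N ≤ T.potential N + Nat.log 2 N := by
  have hs := h.add_le_of_top hu hv huv hpu hpv
  have h2 := Finset.sum_add_of_eqOn_compl_pair
      (f := fun y => Nat.log 2 ((T.nest u v).s y + 1))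
      (g := fun y => Nat.log 2 (T.s y + 1)) hu hv huv
      (fun u hu hu' => by simp [BottleneckTree.nest, hu'])
  have h3 : Nat.log 2 (T.s v + T.s u + 1 + 1) ≤ Nat.log 2 N := Nat.log_mono_right (by omega)
  simp only [potential]
  simp only [BottleneckTree.nest, Function.update_apply, if_true, if_neg huv] at h2 ⊢
  omega

/-- The tree `T'` arises from `T` by the insertion of an edge of weight `c` between `u` and `v`,
which makes an edge of weight `r` superfluous. -/
structure Inserts (N : ℕ) (T T' : BottleneckTree) (u v c r : ℕ) : Prop where
  rel_eq : ∀ θ, T'.rel N θ =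
    T.rel N θ ⊔ Relation.EqvGen.setoid fun a b => a = u ∧ b = v ∧ θ ≤ c
  le_iff : ∀ θ, θ ≤ r ↔ θ ≤ c ∧ T.rel N θ u v
  heavyCount_eq : ∀ θ, T'.heavyCount N θ + (if θ ≤ r then 1 else 0) =
    T.heavyCount N θ + (if θ ≤ c then 1 else 0)

theorem Inserts.refl (T : BottleneckTree) (u c : ℕ) : Inserts N T T u u c c where
  rel_eq θ := by
    refine (sup_eq_left.2 (Setoid.eqvGen_le ?_)).symm
    rintro _ _ ⟨rfl, rfl, -⟩
    exact Setoid.refl' _ _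
  le_iff θ := ⟨fun h => ⟨h, Setoid.refl' _ _⟩, fun h => h.1⟩
  heavyCount_eq _ := rfl

theorem Inserts.symm {T T' : BottleneckTree} {u v c r : ℕ} (h : Inserts N T T' u v c r) :
    Inserts N T T' v u c r where
  rel_eq θ := by
    rw [h.rel_eq]
    congr 1
    apply le_antisymm <;> refine Setoid.eqvGen_le ?_ <;> rintro _ _ ⟨rfl, rfl, hθ⟩ <;>
      exact .symm _ _ (.rel _ _ ⟨rfl, rfl, hθ⟩)
  le_iff θ := by
    rw [h.le_iff, Setoid.comm']
  heavyCount_eq := h.heavyCount_eq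

theorem Inserts.congr_left {T₀ T T' : BottleneckTree} {u v c r : ℕ} (h : Inserts N T T' u v c r)
    (hrel : ∀ θ, T.rel N θ = T₀.rel N θ) (hcount : ∀ θ, T.heavyCount N θ = T₀.heavyCount N θ) :
    Inserts N T₀ T' u v c r where
  rel_eq θ := hrel θ ▸ h.rel_eq θ
  le_iff θ := hrel θ ▸ h.le_iff θ
  heavyCount_eq θ := hcount θ ▸ h.heavyCount_eq θ

theorem WF.raise (h : T.WF N B) {c : ℕ} (hc : c ≤ B) : (T.raise u c).WF N B := by
  refine ⟨h.p_le, fun t ht => ?_, h.s_lt, h.s_eq⟩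
  have := h.w_le t ht
  simp only [BottleneckTree.raise, Function.update_apply]
  split_ifs with htu
  · subst htu
    omega
  · omega

/-- The new edge is parallel to a tree edge; the heavier one of the two stays and the lighter one is
superfluous. `WF.rel_p_iff` identifies this with the bottleneck condition. -/
theorem WF.inserts_raise (h : T.WF N B) (hu : u ∈ Finset.Icc 1 N) (c : ℕ) :
    Inserts N T (T.raise u c) u (T.p u) c (min (T.w u) c) where
  rel_eq θ := by
    have e1 : (T.raise u c).w u = max (T.w u) c := by simp [BottleneckTree.raise]
    have e2 : ∀ t, t ≠ u → (T.raise u c).w t = T.w t := fun t h => by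
      simp [BottleneckTree.raise, h]
    have e3 : ∀ t, T.w t ≤ (T.raise u c).w t := fun t => by
      by_cases htu : t = u
      · subst htu; omega
      · exact (e2 t htu).ge
    apply le_antisymm
    · refine rel_le fun t ht hθ => ?_
      by_cases htu : t = u
      · subst htu
        rw [e1] at hθ
        rcases le_max_iff.1 hθ with h' | h'
        · exact (le_sup_left : T.rel N θ ≤ _) (rel_p hu h')
        · exact (le_sup_right : _ ≤ T.rel N θ ⊔ _) (.rel _ _ ⟨rfl, rfl, h'⟩)
      · rw [e2 t htu] at hθ
        exact (le_sup_left : T.rel N θ ≤ _) (rel_p ht hθ)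
    · refine sup_le (rel_le fun t ht hθ => ?_) (Setoid.eqvGen_le ?_)
      · exact rel_p (T := T.raise u c) ht (hθ.trans (e3 t))
      · rintro _ _ ⟨rfl, rfl, hθ⟩
        exact rel_p (T := T.raise _ c) hu (by omega)
  le_iff θ := by
    rw [h.rel_p_iff hu]
    omega
  heavyCount_eq θ := by
    simp only [heavyCount]
    rw [← Finset.add_sum_erase _ _ hu, ← Finset.add_sum_erase _ _ hu,
      Finset.sum_congr rfl fun t ht => by
        rw [show (T.raise u c).w t = T.w t by
          simp [BottleneckTree.raise, Finset.ne_of_mem_erase ht]],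
      show (T.raise u c).w u = max (T.w u) c by simp [BottleneckTree.raise]]
    grind

/-- If the components that satisfy `P` are the classes that do not contain the root, then each of
them has exactly one top, a vertex below an edge of weight less than `θ`. -/
theorem WF.card_add_heavyCount (h : T.WF N B) {V : Type*} (H : SimpleGraph V) (φ : V → ℕ) {θ : ℕ}
    (hφ : Set.range φ = Set.Icc 1 N) (P : H.ConnectedComponent → Prop)
    (h0 : ∀ x, T.rel N θ (φ x) 0 ↔ ¬ P (H.connectedComponentMk x))
    (hP : ∀ x y, P (H.connectedComponentMk x) →
      (T.rel N θ (φ x) (φ y) ↔ H.connectedComponentMk x = H.connectedComponentMk y)) :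
    Nat.card {c // P c} + T.heavyCount N θ = N := by
  have hφ' : ∀ x, φ x ∈ Finset.Icc 1 N := fun x => by
    have : φ x ∈ Set.Icc 1 N := hφ ▸ Set.mem_range_self x
    simpa using this
  have hcard : Nat.card {c // P c} = ((Finset.Icc 1 N).filter fun x => T.w x < θ).card := by
    have hex : ∀ t : (Finset.Icc 1 N).filter fun x => T.w x < θ, ∃ x, φ x = t := fun t => by
      have : (t : ℕ) ∈ Set.Icc 1 N := by simpa using (Finset.mem_filter.1 t.2).1
      rwa [← hφ] at this
    choose g hg using hex
    have hw : ∀ t, T.top N θ (φ (g t)) = t := fun t => by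
      rw [hg]
      exact top_of_lt T (Finset.mem_filter.1 t.2).2
    rw [← Nat.card_eq_finsetCard]
    have hPg : ∀ t, P (H.connectedComponentMk (g t)) := fun t => by
      by_contra hc
      have h1 := (rel_iff_top_eq h).1 ((h0 _).2 hc)
      have h2 := (Finset.mem_Icc.1 (hφ' (g t))).1
      rw [hw, top_zero, ← hg] at h1
      omega
    symm
    refine Nat.card_eq_of_bijective (fun t => ⟨H.connectedComponentMk (g t), hPg t⟩) ⟨?_, ?_⟩
    · intro t t' htt
      have h1 := (hP _ _ (hPg t)).2 (congrArg Subtype.val htt)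
      rw [rel_iff_top_eq h, hw, hw] at h1
      exact Subtype.ext h1
    · rintro ⟨c, hc⟩
      induction c using SimpleGraph.ConnectedComponent.ind with
      | _ x =>
        have hx := hφ' x
        rcases top_eq_zero_or h θ hx with h1 | ⟨h1, -, h2⟩
        · rw [← top_zero (N := N) T θ, ← rel_iff_top_eq h, h0] at h1
          exact absurd hc h1
        · let t : (Finset.Icc 1 N).filter fun x => T.w x < θ :=
            ⟨T.top N θ (φ x), Finset.mem_filter.2 ⟨h1, h2⟩⟩
          refine ⟨t, Subtype.ext ?_⟩
          have h3 := rel_top (N := N) T θ (φ x)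
          rw [show T.top N θ (φ x) = φ (g t) from (hg t).symm, hP _ _ hc] at h3
          exact h3.symm
  have : T.heavyCount N θ = ((Finset.Icc 1 N).filter fun x => ¬ T.w x < θ).card := by
    rw [Finset.card_filter]
    exact Finset.sum_congr rfl fun x _ => by simp
  rw [hcard, this, Finset.card_filter_add_card_filter_not, Nat.card_Icc, Nat.add_sub_cancel]

end BottleneckTree

/-! ## Programs for bottleneck trees -/

namespace RAM

open BottleneckTree

attribute [local simp] Expr.Fits Expr.val Expr.cost Cond.Fits Cond.Holds Cond.cost Memory.setReg
  Memory.setArr Function.update_apply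

/-- The tree with parents, weights and sizes in the arrays `a`, `a + 1` and `a + 2`. -/
def treeAt (a : ℕ) (σ : Memory) : BottleneckTree := ⟨σ.arr a, σ.arr (a + 1), σ.arr (a + 2)⟩

/-- At most the registers `lo, …, hi` and the arrays of the tree at `a` are changed. -/
structure Frame (a lo hi : ℕ) (σ τ : Memory) : Prop where
  reg_eq : ∀ r, r < lo ∨ hi < r → τ.reg r = σ.reg r
  arr_eq : ∀ b, b < a ∨ a + 2 < b → τ.arr b = σ.arr b

theorem Frame.refl (a lo hi : ℕ) (σ : Memory) : Frame a lo hi σ σ := ⟨fun _ _ => rfl, fun _ _ => rfl⟩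

theorem Frame.trans {a lo hi : ℕ} {σ τ υ : Memory} (h : Frame a lo hi σ τ)
    (h' : Frame a lo hi τ υ) : Frame a lo hi σ υ :=
  ⟨fun r hr => (h'.reg_eq r hr).trans (h.reg_eq r hr),
    fun b hb => (h'.arr_eq b hb).trans (h.arr_eq b hb)⟩

theorem Frame.mono {a lo hi lo' hi' : ℕ} {σ τ : Memory} (h : Frame a lo hi σ τ) (hlo : lo' ≤ lo)
    (hhi : hi ≤ hi') : Frame a lo' hi' σ τ :=
  ⟨fun r hr => h.reg_eq r (by omega), h.arr_eq⟩

/-- Promote the vertex in register `7`. -/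
def promoteProgram (a : ℕ) : Program :=
  .seq (.assign 8 (.get a (.reg 7))) <|
  .seq (.assign 9 (.get a (.reg 8))) <|
  .ite (.lt (.get (a + 1) (.reg 8)) (.get (a + 1) (.reg 7)))
    (.seq (.assign 10 (.get (a + 1) (.reg 7))) <|
     .seq (.store (a + 1) (.reg 7) (.get (a + 1) (.reg 8))) <|
     .seq (.store (a + 1) (.reg 8) (.reg 10)) <|
     .seq (.assign 10 (.get (a + 2) (.reg 8))) <|
     .seq (.store (a + 2) (.reg 8) (.sub (.reg 10) (.add (.get (a + 2) (.reg 7)) (.lit 1)))) <|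
     .seq (.store (a + 2) (.reg 7) (.reg 10)) <|
     .seq (.store a (.reg 8) (.reg 7)) (.store a (.reg 7) (.reg 9)))
    (.seq (.store (a + 2) (.reg 8)
        (.sub (.get (a + 2) (.reg 8)) (.add (.get (a + 2) (.reg 7)) (.lit 1))))
      (.store a (.reg 7) (.reg 9)))

theorem ensures_promoteProgram {W S N B a : ℕ} {σ : Memory} (hW : 4 * N + B + 10 < W) (hS : N < S)
    (hT : (treeAt a σ).WF N B) (hx : σ.reg 7 ∈ Finset.Icc 1 N)
    (h0 : (treeAt a σ).p (σ.reg 7) ≠ 0) :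
    Ensures W S (promoteProgram a) σ fun t τ =>
      t ≤ 100 ∧ treeAt a τ = (treeAt a σ).promote (σ.reg 7) ∧ Frame a 7 10 σ τ := by
  have hy := hT.p_mem hx h0
  have hyx := hT.p_ne hx
  have e1 := hT.p_le _ hy
  have e2 := hT.w_le _ hy
  have e3 := hT.w_le _ hx
  have e4 := hT.s_lt _ hy
  have e5 := hT.s_lt _ hx
  rw [Finset.mem_Icc] at hx hy
  simp only [treeAt] at *
  generalize hxx : σ.reg 7 = x at *
  generalize hyy : σ.arr a x = y at *
  unfold promoteProgram
  repeat' first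
    | apply ensures_seq
    | refine ensures_assign ?_ ?_
    | refine ensures_store ?_ ?_ ?_ ?_
    | refine ensures_ite ?_ (fun hc => ?_) (fun hc => ?_)
  all_goals try simp [hxx, hyy] at hc
  all_goals simp [hxx, hyy]
  all_goals try omega
  · refine ⟨by simp [promote, rotate, hyy, hc], ?_, ?_⟩ <;> intro r hr <;>
      simp only [Function.update_apply] <;> split_ifs <;> first | omega | rfl
  · refine ⟨by simp [promote, shortcut, hyy, hc], ?_, ?_⟩ <;> intro r hr <;>
      simp only [Function.update_apply] <;> split_ifs <;> first | omega | rfl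

/-- Select the vertex to be promoted in order to bring the vertex in register `11` to the top. -/
def selectProgram (a : ℕ) : Program :=
  .seq (.assign 7 (.reg 11)) <|
  .seq (.assign 8 (.get a (.reg 11))) <|
  .seq (.assign 9 (.get a (.reg 8))) <|
  .ite (.eq (.reg 9) (.lit 0)) .skip <|
  .ite (.eq (.get a (.reg 9)) (.lit 0)) .skip <|
  -- With `y` and `z` in the registers `8` and `9`, the test `2 * (s z + 1) ≤ 3 * (s y + 1)` is
  -- written as `2 * s z < 3 * s y + 2`, with additions only.
  .ite (.lt (.add (.get (a + 2) (.reg 9)) (.get (a + 2) (.reg 9)))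
      (.add (.get (a + 2) (.reg 8)) (.add (.get (a + 2) (.reg 8))
        (.add (.get (a + 2) (.reg 8)) (.lit 2)))))
    (.assign 7 (.reg 8)) .skip

theorem ensures_selectProgram {W S N B a : ℕ} {σ : Memory} (hW : 4 * N + B + 10 < W) (hS : N < S)
    (hT : (treeAt a σ).WF N B) (hu : σ.reg 11 ∈ Finset.Icc 1 N)
    (h0 : (treeAt a σ).p (σ.reg 11) ≠ 0) :
    Ensures W S (selectProgram a) σ fun t τ =>
      t ≤ 60 ∧ τ.reg 7 = (treeAt a σ).nextPromoted (σ.reg 11) ∧ τ.arr = σ.arr ∧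
        Frame a 7 10 σ τ := by
  obtain ⟨u, hxx⟩ : ∃ u, σ.reg 11 = u := ⟨_, rfl⟩
  rw [hxx] at hu h0 ⊢
  obtain ⟨y, hyy⟩ : ∃ y, σ.arr a u = y := ⟨_, rfl⟩
  obtain ⟨z, hzz⟩ : ∃ z, σ.arr a y = z := ⟨_, rfl⟩
  have hy : y ∈ Finset.Icc 1 N := hyy ▸ hT.p_mem hu h0
  have e1 : z ≤ N := hzz ▸ hT.p_le _ hy
  have e4 : σ.arr (a + 2) y < N := hT.s_lt _ hy
  have e6 : z ≠ 0 → σ.arr a z ≤ N ∧ σ.arr (a + 2) z < N := fun h =>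
    ⟨hT.p_le z (by simp; omega), hT.s_lt z (by simp; omega)⟩
  rw [Finset.mem_Icc] at hu hy
  have hn : (treeAt a σ).nextPromoted u = if z ≠ 0 ∧ σ.arr a z ≠ 0 ∧
      2 * (σ.arr (a + 2) z + 1) ≤ 3 * (σ.arr (a + 2) y + 1) then y else u := by
    subst hzz hyy
    rfl
  rw [hn]
  have hF : ∀ f : ℕ → ℕ, (∀ r, r < 7 ∨ 10 < r → f r = σ.reg r) → Frame a 7 10 σ ⟨f, σ.arr⟩ :=
    fun f hf => ⟨hf, fun _ _ => rfl⟩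
  unfold selectProgram
  repeat' first
    | apply ensures_seq
    | refine ensures_assign ?_ ?_
    | refine ensures_skip ?_
    | refine ensures_ite ?_ (fun hc => ?_) (fun hc => ?_)
  all_goals try simp [hxx, hyy, hzz] at *
  all_goals try omega
  all_goals
    refine ⟨by omega, hF _ fun r hr => ?_⟩
    simp only [Function.update_apply]
    split_ifs <;> omega

/-- Bring the vertex in register `11` to the top. -/
def perchProgram (a : ℕ) : Program :=
  .while (.not (.eq (.get a (.reg 11)) (.lit 0))) (.seq (selectProgram a) (promoteProgram a))

/-- The tree `T'` has the same connections as `T`, and `u` is at the top. -/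
structure Perched (N B : ℕ) (T T' : BottleneckTree) (u : ℕ) : Prop where
  wf : T'.WF N B
  rel_eq : ∀ θ, T'.rel N θ = T.rel N θ
  heavyCount_eq : ∀ θ, T'.heavyCount N θ = T.heavyCount N θ
  p_eq : T'.p u = 0
  p_other : ∀ o, T.p o = 0 → T'.p o = 0 ∨ T'.p o = u

/-- A round takes fewer than `200` steps and lowers the credit by at least one. Passing between
credit and potential at both ends costs `3 * log N + 3` units, by `credit_le` and
`WF.potential_le_credit`. -/
theorem ensures_perchProgram {W S N B a : ℕ} {σ : Memory} (hW : 4 * N + B + 10 < W) (hS : N < S)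
    (hT : (treeAt a σ).WF N B) (hu : σ.reg 11 ∈ Finset.Icc 1 N) :
    Ensures W S (perchProgram a) σ fun t τ =>
      t + 200 * (treeAt a τ).potential N ≤
        200 * (treeAt a σ).potential N + 600 * (Nat.log 2 N + 1) + 10 ∧
      Perched N B (treeAt a σ) (treeAt a τ) (σ.reg 11) ∧ Frame a 7 10 σ τ := by
  obtain ⟨u, hxx⟩ : ∃ u, σ.reg 11 = u := ⟨_, rfl⟩
  rw [hxx] at hu ⊢
  refine (ensures_while
    (fun τ => (treeAt a τ).WF N B ∧ Frame a 7 10 σ τ ∧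
      (∀ θ, (treeAt a τ).rel N θ = (treeAt a σ).rel N θ) ∧
      (∀ θ, (treeAt a τ).heavyCount N θ = (treeAt a σ).heavyCount N θ) ∧
      -- The second alternative includes that `u` is at the top, so it cannot hold at the start of a
      -- further round.
      ∀ o, (treeAt a σ).p o = 0 →
        (treeAt a τ).p o = 0 ∨ (treeAt a τ).p o = u ∧ (treeAt a τ).p u = 0)
    (fun τ => 200 * (treeAt a τ).credit N u) ?_ ?_ ?_).mono ?_
  · rintro τ ⟨hwf, hf, -⟩
    have h11 : τ.reg 11 = u := (hf.reg_eq 11 (by omega)).trans hxx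
    have := hwf.p_le u hu
    rw [Finset.mem_Icc] at hu
    simp only [treeAt] at this
    simp [h11]
    omega
  · rintro τ ⟨hwf, hf, hrel, hcnt, hoth⟩ hb
    have h11 : τ.reg 11 = u := (hf.reg_eq 11 (by omega)).trans hxx
    have h0 : (treeAt a τ).p u ≠ 0 := by simpa [h11, treeAt] using hb
    have hnext := hwf.nextPromoted_mem hu h0
    refine ensures_seq ((ensures_selectProgram hW hS hwf (h11 ▸ hu) (h11 ▸ h0)).mono ?_)
    rintro t₁ τ₁ ⟨ht₁, h7, harr, hf₁⟩
    have htree : treeAt a τ₁ = treeAt a τ := by simp [treeAt, harr]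
    rw [h11] at h7
    refine (ensures_promoteProgram hW hS (htree ▸ hwf) (h7 ▸ hnext.1)
      (by rw [htree, h7]; exact hnext.2)).mono ?_
    rintro t₂ τ₂ ⟨ht₂, htree₂, hf₂⟩
    rw [htree, h7] at htree₂
    have hcr := hwf.credit_promote_lt hu h0
    rw [htree₂]
    refine ⟨⟨hwf.promote hnext.1 hnext.2, (hf.trans hf₁).trans hf₂,
      fun θ => (hwf.rel_promote hnext.1 hnext.2 θ).trans (hrel θ),
      fun θ => (hwf.heavyCount_promote hnext.1 hnext.2 θ).trans (hcnt θ), fun o ho => ?_⟩, ?_⟩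
    · exact p_promote_eq_zero_or _ h0 ((hoth o ho).resolve_right fun h => h0 h.2)
    · simp
      omega
  · exact ⟨hT, Frame.refl _ _ _ _, fun _ => rfl, fun _ => rfl, fun o ho => .inl ho⟩
  · rintro t τ ⟨⟨hwf, hf, hrel, hcnt, hoth⟩, hb, ht⟩
    have h11 : τ.reg 11 = u := (hf.reg_eq 11 (by omega)).trans hxx
    have h0 : (treeAt a τ).p u = 0 := by simpa [h11, treeAt] using hb
    have h1 := credit_le (N := N) (treeAt a σ) u
    have h2 := hwf.potential_le_credit hu
    refine ⟨?_, ⟨hwf, hrel, hcnt, h0, fun o ho => (hoth o ho).imp_right And.left⟩, hf⟩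
    simp at ht
    omega

/-- Raise the weight above the vertex in register `12` to at least the number in register `5`, and
put the smaller one of both weights into register `6`. -/
def raiseProgram (a : ℕ) : Program :=
  .ite (.lt (.get (a + 1) (.reg 12)) (.reg 5))
    (.seq (.assign 6 (.get (a + 1) (.reg 12))) (.store (a + 1) (.reg 12) (.reg 5)))
    (.assign 6 (.reg 5))

theorem ensures_raiseProgram {W S N B a : ℕ} {σ : Memory} (hW : 4 * N + B + 10 < W) (hS : N < S)
    (hT : (treeAt a σ).WF N B) (hu : σ.reg 12 ∈ Finset.Icc 1 N) (hc : σ.reg 5 ≤ B) :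
    Ensures W S (raiseProgram a) σ fun t τ =>
      t ≤ 20 ∧ treeAt a τ = (treeAt a σ).raise (σ.reg 12) (σ.reg 5) ∧
        τ.reg 6 = min ((treeAt a σ).w (σ.reg 12)) (σ.reg 5) ∧ Frame a 6 6 σ τ := by
  obtain ⟨u, hxx⟩ : ∃ u, σ.reg 12 = u := ⟨_, rfl⟩
  obtain ⟨c, hcc⟩ : ∃ c, σ.reg 5 = c := ⟨_, rfl⟩
  rw [hxx] at hu ⊢
  rw [hcc] at hc ⊢
  have e1 : σ.arr (a + 1) u ≤ B := hT.w_le u hu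
  rw [Finset.mem_Icc] at hu
  unfold raiseProgram
  repeat' first
    | apply ensures_seq
    | refine ensures_assign ?_ ?_
    | refine ensures_store ?_ ?_ ?_ ?_
    | refine ensures_ite ?_ (fun hc => ?_) (fun hc => ?_)
  all_goals simp [hxx, hcc] at *
  all_goals try omega
  · refine ⟨?_, (min_eq_left hc.le).symm, ?_, ?_⟩
    · simp [treeAt, raise, max_eq_right hc.le]
    all_goals
      intro r hr
      simp only [Function.update_apply]
      split_ifs <;> first | omega | rfl
  · refine ⟨?_, hc, ?_, fun _ _ => rfl⟩
    · simp only [treeAt, raise, max_eq_left hc, Function.update_eq_self]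
    · intro r hr
      simp only [Function.update_apply]
      split_ifs <;> omega

/-- Make the vertex in register `12` a child of the vertex in register `13`. -/
def nestProgram (a : ℕ) : Program :=
  .seq (.store a (.reg 12) (.reg 13))
    (.store (a + 2) (.reg 13)
      (.add (.add (.get (a + 2) (.reg 13)) (.get (a + 2) (.reg 12))) (.lit 1)))

theorem ensures_nestProgram {W S N B a : ℕ} {σ : Memory} (hW : 4 * N + B + 10 < W) (hS : N < S)
    (hT : (treeAt a σ).WF N B) (hu : σ.reg 12 ∈ Finset.Icc 1 N) (hv : σ.reg 13 ∈ Finset.Icc 1 N) :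
    Ensures W S (nestProgram a) σ fun t τ =>
      t ≤ 20 ∧ treeAt a τ = (treeAt a σ).nest (σ.reg 12) (σ.reg 13) ∧ τ.reg = σ.reg ∧
        Frame a 12 13 σ τ := by
  obtain ⟨u, hxx⟩ : ∃ u, σ.reg 12 = u := ⟨_, rfl⟩
  obtain ⟨v, hyy⟩ : ∃ v, σ.reg 13 = v := ⟨_, rfl⟩
  rw [hxx] at hu ⊢
  rw [hyy] at hv ⊢
  have e1 : σ.arr (a + 2) u < N := hT.s_lt u hu
  have e2 : σ.arr (a + 2) v < N := hT.s_lt v hv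
  rw [Finset.mem_Icc] at hu hv
  unfold nestProgram
  repeat' first
    | apply ensures_seq
    | refine ensures_store ?_ ?_ ?_ ?_
  all_goals simp [hxx, hyy]
  all_goals try omega
  refine ⟨by simp [treeAt, nest], fun _ _ => rfl, fun r hr => ?_⟩
  simp only [Function.update_apply]
  split_ifs <;> first | omega | rfl

/-- Insert an edge from the vertex in register `3` to the root, of the weight in register `5`. The
weight of the superfluous edge is put into register `6`. -/
def insertStarProgram (a : ℕ) : Program :=
  .seq (.assign 11 (.reg 3)) <| .seq (perchProgram a) <|
  .seq (.assign 12 (.reg 3)) <| raiseProgram a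

theorem treeAt_setReg (a : ℕ) (σ : Memory) (x v : ℕ) : treeAt a (σ.setReg x v) = treeAt a σ := rfl

theorem frame_setReg (a lo hi : ℕ) (σ : Memory) {x : ℕ} (v : ℕ) (h : lo ≤ x) (h' : x ≤ hi) :
    Frame a lo hi σ (σ.setReg x v) :=
  ⟨fun r hr => by simp [show r ≠ x by omega], fun _ _ => rfl⟩

/-- Once the vertex is a child of the root, the new edge is parallel to the edge above it. -/
theorem ensures_insertStarProgram {W S N B a : ℕ} {σ : Memory} (hW : 4 * N + B + 10 < W)
    (hS : N < S) (hT : (treeAt a σ).WF N B) (hu : σ.reg 3 ∈ Finset.Icc 1 N) (hc : σ.reg 5 ≤ B) :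
    Ensures W S (insertStarProgram a) σ fun t τ =>
      t + 200 * (treeAt a τ).potential N ≤
        200 * (treeAt a σ).potential N + 2000 * (Nat.log 2 N + 1) ∧
      (treeAt a τ).WF N B ∧
      Inserts N (treeAt a σ) (treeAt a τ) (σ.reg 3) 0 (σ.reg 5) (τ.reg 6) ∧
      Frame a 6 13 σ τ := by
  have hu' := (Finset.mem_Icc.1 hu).2
  refine ensures_seq (ensures_assign (by simp; omega) ?_)
  set σ₁ := σ.setReg 11 (Expr.val σ (.reg 3)) with hσ₁
  have h11 : σ₁.reg 11 = σ.reg 3 := by simp [hσ₁]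
  refine ensures_seq ((ensures_perchProgram hW hS (a := a) (σ := σ₁) hT (h11 ▸ hu)).mono ?_)
  rintro t τ ⟨ht, hp, hf⟩
  rw [h11] at hp
  have hf' : Frame a 6 13 σ τ :=
    (frame_setReg _ _ _ _ _ (by omega) (by omega)).trans (hf.mono (by omega) (by omega))
  have h3 := hf'.reg_eq 3 (by omega)
  have h5 := hf'.reg_eq 5 (by omega)
  refine ensures_seq (ensures_assign (by simp [h3]; omega) ?_)
  set σ₂ := τ.setReg 12 (Expr.val τ (.reg 3)) with hσ₂
  have h12 : σ₂.reg 12 = σ.reg 3 := by simp [hσ₂, h3]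
  have h5' : σ₂.reg 5 = σ.reg 5 := by simp [hσ₂, h5]
  refine (ensures_raiseProgram hW hS (a := a) (σ := σ₂) hp.wf (h12 ▸ hu) (h5' ▸ hc)).mono ?_
  rintro t' τ' ⟨ht', htree, h6, hf''⟩
  rw [h12, h5', hσ₂, treeAt_setReg] at htree h6
  rw [htree, h6]
  refine ⟨?_, hp.wf.raise hc, ?_, hf'.trans
    ((frame_setReg _ _ _ _ _ (by omega) (by omega)).trans (hf''.mono (by omega) (by omega)))⟩
  · have : ((treeAt a τ).raise (σ.reg 3) (σ.reg 5)).potential N = (treeAt a τ).potential N := rfl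
    rw [hσ₁, treeAt_setReg] at ht
    simp
    omega
  · have := hp.wf.inserts_raise hu (σ.reg 5)
    rw [hp.p_eq] at this
    exact this.congr_left hp.rel_eq hp.heavyCount_eq

/-- Make one of the vertices in the registers `3` and `4` a child of the other one, where the
second one is at the top. The child is put into register `12`. -/
def joinProgram (a : ℕ) : Program :=
  .seq (.assign 12 (.reg 3)) <| .seq (.assign 13 (.reg 4)) <|
  .ite (.eq (.get a (.reg 12)) (.lit 0))
    (.seq
      (.ite (.lt (.get (a + 1) (.reg 13)) (.get (a + 1) (.reg 12)))
        (.seq (.assign 12 (.reg 4)) (.assign 13 (.reg 3))) .skip)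
      (nestProgram a))
    .skip

/-- The tree `T'` has the same connections as `T`, and `v` is the parent of `u`. -/
structure Joined (N B : ℕ) (T T' : BottleneckTree) (u v : ℕ) : Prop where
  wf : T'.WF N B
  rel_eq : ∀ θ, T'.rel N θ = T.rel N θ
  heavyCount_eq : ∀ θ, T'.heavyCount N θ = T.heavyCount N θ
  p_eq : T'.p u = v
  potential_le : T'.potential N ≤ T.potential N + Nat.log 2 N

theorem joined_nest {N B : ℕ} {T : BottleneckTree} {u v : ℕ} (hT : T.WF N B)
    (hu : u ∈ Finset.Icc 1 N) (hv : v ∈ Finset.Icc 1 N) (huv : u ≠ v)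
    (hpu : T.p u = 0) (hpv : T.p v = 0) (hw : T.w u ≤ T.w v) : Joined N B T (T.nest u v) u v where
  wf := hT.nest hu hv huv hpu hpv
  rel_eq := WF.rel_nest hu hv huv hpu hpv hw
  heavyCount_eq _ := rfl
  p_eq := by simp [nest]
  potential_le := hT.potential_nest_le hu hv huv hpu hpv

/-- If both vertices are children of the root, the one below the lighter edge has to become the
child, as `WF.rel_nest` demands. Hence the two possible outcomes. -/
theorem ensures_joinProgram {W S N B a : ℕ} {σ : Memory} (hW : 4 * N + B + 10 < W) (hS : N < S)
    (hT : (treeAt a σ).WF N B) (hu : σ.reg 3 ∈ Finset.Icc 1 N) (hv : σ.reg 4 ∈ Finset.Icc 1 N)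
    (huv : σ.reg 3 ≠ σ.reg 4) (hpv : (treeAt a σ).p (σ.reg 4) = 0)
    (hpu : (treeAt a σ).p (σ.reg 3) = 0 ∨ (treeAt a σ).p (σ.reg 3) = σ.reg 4) :
    Ensures W S (joinProgram a) σ fun t τ => t ≤ 60 ∧ Frame a 12 13 σ τ ∧
      (τ.reg 12 = σ.reg 3 ∧ Joined N B (treeAt a σ) (treeAt a τ) (σ.reg 3) (σ.reg 4) ∨
       τ.reg 12 = σ.reg 4 ∧ Joined N B (treeAt a σ) (treeAt a τ) (σ.reg 4) (σ.reg 3)) := by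
  have hu' := Finset.mem_Icc.1 hu
  have hv' := Finset.mem_Icc.1 hv
  have e1 := hT.p_le _ hu
  have e2 := hT.w_le _ hu
  have e3 := hT.w_le _ hv
  simp only [treeAt] at e1 e2 e3
  refine ensures_seq (ensures_assign (by simp; omega) ?_)
  refine ensures_seq (ensures_assign (by simp; omega) ?_)
  refine ensures_ite (by simp; omega) (fun hc => ?_) (fun hc => ensures_skip ?_)
  · have hpu : (treeAt a σ).p (σ.reg 3) = 0 := by simpa [treeAt] using hc
    refine ensures_seq (ensures_ite (by simp; omega)
      (fun hc' => ensures_seq (ensures_assign (by simp; omega)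
        (ensures_assign (by simp; omega) ?_))) (fun hc' => ensures_skip ?_))
    · refine (ensures_nestProgram (N := N) (B := B) hW hS ?_ ?_ ?_).mono ?_
      · exact hT
      · simpa using hv'
      · simpa using hu'
      · rintro t τ ⟨ht, htree, hreg, hf⟩
        have hw : (treeAt a σ).w (σ.reg 4) < (treeAt a σ).w (σ.reg 3) := by
          simpa [treeAt] using hc'
        simp only [treeAt_setReg] at htree
        simp at htree
        refine ⟨by simp; omega, ?_, .inr ⟨by rw [hreg]; simp, ?_⟩⟩
        · refine Frame.trans ?_ hf
          iterate 3 refine Frame.trans ?_ (frame_setReg _ _ _ _ _ (by omega) (by omega))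
          exact frame_setReg _ _ _ _ _ (by omega) (by omega)
        · rw [htree]
          exact joined_nest hT hv hu huv.symm hpv hpu hw.le
    · refine (ensures_nestProgram (N := N) (B := B) hW hS ?_ ?_ ?_).mono ?_
      · exact hT
      · simpa using hu'
      · simpa using hv'
      · rintro t τ ⟨ht, htree, hreg, hf⟩
        have hw : (treeAt a σ).w (σ.reg 3) ≤ (treeAt a σ).w (σ.reg 4) := by
          simpa [treeAt] using hc'
        simp only [treeAt_setReg] at htree
        simp at htree
        refine ⟨by simp; omega, ?_, .inl ⟨by rw [hreg]; simp, ?_⟩⟩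
        · refine Frame.trans ?_ hf
          refine Frame.trans ?_ (frame_setReg _ _ _ _ _ (by omega) (by omega))
          exact frame_setReg _ _ _ _ _ (by omega) (by omega)
        · rw [htree]
          exact joined_nest hT hu hv huv hpu hpv hw
  · have hpu' : (treeAt a σ).p (σ.reg 3) ≠ 0 := by simpa [treeAt] using hc
    refine ⟨by simp, ?_, .inl ⟨by simp, ?_⟩⟩
    · refine Frame.trans ?_ (frame_setReg _ _ _ _ _ (by omega) (by omega))
      exact frame_setReg _ _ _ _ _ (by omega) (by omega)
    · exact ⟨hT, fun _ => rfl, fun _ => rfl, hpu.resolve_left hpu', Nat.le_add_right _ _⟩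

/-- Insert an edge between the vertices in the registers `3` and `4`, of the weight in register
`5`. The weight of the superfluous edge is put into register `6`. -/
def insertEdgeProgram (a : ℕ) : Program :=
  .ite (.eq (.reg 3) (.reg 4)) (.assign 6 (.reg 5)) <|
  .seq (.assign 11 (.reg 3)) <| .seq (perchProgram a) <|
  .seq (.assign 11 (.reg 4)) <| .seq (perchProgram a) <|
  .seq (joinProgram a) (raiseProgram a)

/-- Two liftings and a join turn the ends of the edge into parent and child without changing
connections, and then `WF.inserts_raise` applies. Each lifting contributes `600` to the factor of
the logarithm and the nesting `200`; the rest of `2000` covers constants. -/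
theorem ensures_insertEdgeProgram {W S N B a : ℕ} {σ : Memory} (hW : 4 * N + B + 10 < W)
    (hS : N < S) (hT : (treeAt a σ).WF N B) (hu : σ.reg 3 ∈ Finset.Icc 1 N)
    (hv : σ.reg 4 ∈ Finset.Icc 1 N) (hc : σ.reg 5 ≤ B) :
    Ensures W S (insertEdgeProgram a) σ fun t τ =>
      t + 200 * (treeAt a τ).potential N ≤
        200 * (treeAt a σ).potential N + 2000 * (Nat.log 2 N + 1) ∧
      (treeAt a τ).WF N B ∧
      Inserts N (treeAt a σ) (treeAt a τ) (σ.reg 3) (σ.reg 4) (σ.reg 5) (τ.reg 6) ∧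
      Frame a 6 13 σ τ := by
  have hu' := (Finset.mem_Icc.1 hu).2
  have hv' := (Finset.mem_Icc.1 hv).2
  refine ensures_ite (by simp; omega) (fun hc' => ensures_assign (by simp; omega) ?_)
    (fun hc' => ?_)
  -- A loop is superfluous itself, with its full weight.
  · rw [treeAt_setReg]
    have h : σ.reg 3 = σ.reg 4 := by simpa using hc'
    refine ⟨by simp; omega, hT, ?_, frame_setReg _ _ _ _ _ (by omega) (by omega)⟩
    rw [← h]
    simpa using Inserts.refl (treeAt a σ) (σ.reg 3) (σ.reg 5)
  have huv : σ.reg 3 ≠ σ.reg 4 := by simpa using hc'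
  refine ensures_seq (ensures_assign (by simp; omega) ?_)
  set σ₁ := σ.setReg 11 (Expr.val σ (.reg 3)) with hσ₁
  have h11 : σ₁.reg 11 = σ.reg 3 := by simp [hσ₁]
  refine ensures_seq ((ensures_perchProgram hW hS (a := a) (σ := σ₁) hT (h11 ▸ hu)).mono ?_)
  rintro t₁ τ₁ ⟨ht₁, hp₁, hf₁⟩
  rw [h11] at hp₁
  rw [hσ₁, treeAt_setReg] at ht₁ hp₁
  have hf₁' : Frame a 6 13 σ τ₁ :=
    (frame_setReg _ _ _ _ _ (by omega) (by omega)).trans (hf₁.mono (by omega) (by omega))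
  have h4 := hf₁'.reg_eq 4 (by omega)
  refine ensures_seq (ensures_assign (by simp [h4]; omega) ?_)
  set σ₂ := τ₁.setReg 11 (Expr.val τ₁ (.reg 4)) with hσ₂
  have h11 : σ₂.reg 11 = σ.reg 4 := by simp [hσ₂, h4]
  refine ensures_seq
    ((ensures_perchProgram hW hS (a := a) (σ := σ₂) hp₁.wf (h11 ▸ hv)).mono ?_)
  rintro t₂ τ₂ ⟨ht₂, hp₂, hf₂⟩
  rw [h11] at hp₂
  rw [hσ₂, treeAt_setReg] at ht₂ hp₂
  have hf₂' : Frame a 6 13 σ τ₂ := hf₁'.trans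
    ((frame_setReg _ _ _ _ _ (by omega) (by omega)).trans (hf₂.mono (by omega) (by omega)))
  have h3 := hf₂'.reg_eq 3 (by omega)
  have h4 := hf₂'.reg_eq 4 (by omega)
  refine ensures_seq ((ensures_joinProgram hW hS (a := a) (σ := τ₂) hp₂.wf (h3 ▸ hu) (h4 ▸ hv)
    (by rwa [h3, h4]) (h4 ▸ hp₂.p_eq) (by rw [h3, h4]; exact hp₂.p_other _ hp₁.p_eq)).mono ?_)
  rintro t₃ τ₃ ⟨ht₃, hf₃, hj⟩
  have hf₃' : Frame a 6 13 σ τ₃ := hf₂'.trans (hf₃.mono (by omega) (by omega))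
  have h5 := hf₃'.reg_eq 5 (by omega)
  rw [h3, h4] at hj
  have key : ∀ u v, u ∈ Finset.Icc 1 N → τ₃.reg 12 = u →
      Joined N B (treeAt a τ₂) (treeAt a τ₃) u v →
      Ensures W S (raiseProgram a) τ₃ fun t τ =>
        t ≤ 20 ∧ (treeAt a τ).potential N ≤ (treeAt a τ₂).potential N + Nat.log 2 N ∧
        (treeAt a τ).WF N B ∧ Inserts N (treeAt a σ) (treeAt a τ) u v (σ.reg 5) (τ.reg 6) ∧
        Frame a 6 13 σ τ := by
    intro u v hu h12 hj
    refine (ensures_raiseProgram hW hS hj.wf (h12 ▸ hu) (h5 ▸ hc)).mono ?_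
    rintro t₄ τ₄ ⟨ht₄, htree, h6, hf₄⟩
    rw [h12, h5] at htree h6
    rw [htree, h6]
    refine ⟨ht₄, hj.potential_le, hj.wf.raise hc, ?_,
      hf₃'.trans (hf₄.mono (by omega) (by omega))⟩
    have := hj.wf.inserts_raise hu (σ.reg 5)
    rw [hj.p_eq] at this
    exact this.congr_left (fun θ => by rw [hj.rel_eq, hp₂.rel_eq, hp₁.rel_eq])
      (fun θ => by rw [hj.heavyCount_eq, hp₂.heavyCount_eq, hp₁.heavyCount_eq])
  rcases hj with ⟨h12, hj⟩ | ⟨h12, hj⟩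
  · refine (key _ _ hu h12 hj).mono ?_
    rintro t₄ τ₄ ⟨ht₄, hpot, hwf, hins, hf⟩
    exact ⟨by simp; omega, hwf, hins, hf⟩
  · refine (key _ _ hv h12 hj).mono ?_
    rintro t₄ τ₄ ⟨ht₄, hpot, hwf, hins, hf⟩
    exact ⟨by simp; omega, hwf, hins.symm, hf⟩

end RAM

/-! ## The history of the three trees -/

theorem Setoid.eqvGen_sup {α : Type*} (r s : α → α → Prop) :
    Relation.EqvGen.setoid r ⊔ Relation.EqvGen.setoid s =
      Relation.EqvGen.setoid fun a b => r a b ∨ s a b :=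
  (Setoid.gi (α := α)).gc.l_sup.symm

/-- The number of `k < j` with `f k` at least `θ`. -/
def countGE (f : ℕ → ℕ) (j θ : ℕ) : ℕ := ∑ k ∈ Finset.range j, if θ ≤ f k then 1 else 0

theorem countGE_succ (f : ℕ → ℕ) (j θ : ℕ) :
    countGE f (j + 1) θ = countGE f j θ + if θ ≤ f j then 1 else 0 :=
  Finset.sum_range_succ _ _

theorem countGE_congr {f g : ℕ → ℕ} {j : ℕ} (h : ∀ k < j, f k = g k) (θ : ℕ) :
    countGE f j θ = countGE g j θ :=
  Finset.sum_congr rfl fun k hk => by rw [h k (Finset.mem_range.1 hk)]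

/-- Connection by the edges from `U k` to `V k` with `θ ≤ k + 1 ≤ j`. -/
def edgeRel (U V : ℕ → ℕ) (j θ : ℕ) : Setoid ℕ :=
  Relation.EqvGen.setoid fun a b => ∃ k < j, a = U k ∧ b = V k ∧ θ ≤ k + 1

/-- Connection by these edges and by edges from `U k` to the root of weight `f k`. -/
def loopRel (U V f : ℕ → ℕ) (j θ : ℕ) : Setoid ℕ :=
  Relation.EqvGen.setoid fun a b => ∃ k < j, a = U k ∧ (b = V k ∧ θ ≤ k + 1 ∨ b = 0 ∧ θ ≤ f k)

/-- Connection by edges from `U k` and `V k` to the root with `θ ≤ k + 1 ≤ j`. -/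
def touchRel (U V : ℕ → ℕ) (j θ : ℕ) : Setoid ℕ :=
  Relation.EqvGen.setoid fun a b => ∃ k < j, (a = U k ∨ a = V k) ∧ b = 0 ∧ θ ≤ k + 1

/-- The trees that maintain the relations `edgeRel`, `loopRel` and `touchRel` after the insertion
of `j` edges, where `R t k` are the weights of the superfluous edges. -/
structure History (N : ℕ) (U V : ℕ → ℕ) (R : ℕ → ℕ → ℕ) (j : ℕ) (T₁ T₂ T₃ : BottleneckTree) :
    Prop where
  -- Thresholds start at one, because the edges to the root that are present at the start have
  -- weight `0`.
  rel₁ : ∀ θ, 1 ≤ θ → T₁.rel N θ = edgeRel U V j θ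
  rel₂ : ∀ θ, 1 ≤ θ → T₂.rel N θ = loopRel U V (R 0) j θ
  rel₃ : ∀ θ, 1 ≤ θ → T₃.rel N θ = touchRel U V j θ
  le_iff : ∀ k < j, ∀ θ, 1 ≤ θ → (θ ≤ R 0 k ↔ θ ≤ k + 1 ∧ edgeRel U V k θ (U k) (V k))
  le_succ : ∀ t < 5, ∀ k < j, R t k ≤ k + 1
  -- Each insertion adds one weight and discards one; subtraction is avoided by moving the discarded
  -- weights to the left.
  count₁ : ∀ θ, 1 ≤ θ → T₁.heavyCount N θ + countGE (R 0) j θ = countGE (· + 1) j θ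
  count₂ : ∀ θ, 1 ≤ θ → T₂.heavyCount N θ + countGE (R 1) j θ + countGE (R 2) j θ =
    countGE (· + 1) j θ + countGE (R 0) j θ
  count₃ : ∀ θ, 1 ≤ θ → T₃.heavyCount N θ + countGE (R 3) j θ + countGE (R 4) j θ =
    2 * countGE (· + 1) j θ

namespace History

open BottleneckTree

variable {N : ℕ} {U V : ℕ → ℕ} {R R' : ℕ → ℕ → ℕ} {j : ℕ}
  {T₁ T₂ T₃ T₁' T₂' T₂'' T₃' T₃'' : BottleneckTree}

theorem congr (h : History N U V R j T₁ T₂ T₃) (hR : ∀ t < 5, ∀ k < j, R t k = R' t k) :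
    History N U V R' j T₁ T₂ T₃ where
  rel₁ := h.rel₁
  rel₂ θ hθ := by
    rw [h.rel₂ θ hθ, loopRel, loopRel]
    congr 1
    funext a b
    refine propext (exists_congr fun k => and_congr_right fun hk => ?_)
    rw [hR 0 (by omega) k hk]
  rel₃ := h.rel₃
  le_iff k hk := hR 0 (by omega) k hk ▸ h.le_iff k hk
  le_succ t ht k hk := hR t ht k hk ▸ h.le_succ t ht k hk
  count₁ θ hθ := countGE_congr (hR 0 (by omega)) θ ▸ h.count₁ θ hθ
  count₂ θ hθ := countGE_congr (hR 0 (by omega)) θ ▸ countGE_congr (hR 1 (by omega)) θ ▸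
    countGE_congr (hR 2 (by omega)) θ ▸ h.count₂ θ hθ
  count₃ θ hθ := countGE_congr (hR 3 (by omega)) θ ▸ countGE_congr (hR 4 (by omega)) θ ▸
    h.count₃ θ hθ

theorem rel_zero {T : BottleneckTree} (hw : ∀ x, T.w x = 0) {θ : ℕ} (hθ : 1 ≤ θ) :
    T.rel N θ = ⊥ := by
  refine le_bot_iff.1 (rel_le fun x _ h => ?_)
  rw [hw] at h
  omega

theorem eqvGen_bot {α : Type*} {r : α → α → Prop} (h : ∀ a b, ¬ r a b) :
    Relation.EqvGen.setoid r = ⊥ :=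
  le_bot_iff.1 (Setoid.eqvGen_le fun a b hab => absurd hab (h a b))

theorem zero {T₁ T₂ T₃ : BottleneckTree} (h₁ : ∀ x, T₁.w x = 0) (h₂ : ∀ x, T₂.w x = 0)
    (h₃ : ∀ x, T₃.w x = 0) : History N U V R 0 T₁ T₂ T₃ := by
  have key : ∀ T : BottleneckTree, (∀ x, T.w x = 0) → ∀ θ, 1 ≤ θ → T.heavyCount N θ = 0 := by
    intro T hT θ hθ
    refine Finset.sum_eq_zero fun x _ => if_neg ?_
    rw [hT]
    omega
  refine ⟨fun θ hθ => ?_, fun θ hθ => ?_, fun θ hθ => ?_, by simp, by simp, fun θ hθ => ?_,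
    fun θ hθ => ?_, fun θ hθ => ?_⟩
  · rw [rel_zero h₁ hθ, edgeRel, eqvGen_bot (by simp)]
  · rw [rel_zero h₂ hθ, loopRel, eqvGen_bot (by simp)]
  · rw [rel_zero h₃ hθ, touchRel, eqvGen_bot (by simp)]
  · simp [key _ h₁ θ hθ, countGE]
  · simp [key _ h₂ θ hθ, countGE]
  · simp [key _ h₃ θ hθ, countGE]

theorem le_of_inserts {T T' : BottleneckTree} {u v c r : ℕ} (h : Inserts N T T' u v c r) : r ≤ c :=
  ((h.le_iff r).1 le_rfl).1

theorem succ (h : History N U V R j T₁ T₂ T₃)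
    (h₁ : Inserts N T₁ T₁' (U j) (V j) (j + 1) (R 0 j))
    (h₂ : Inserts N T₂ T₂' (U j) (V j) (j + 1) (R 1 j))
    (h₂' : Inserts N T₂' T₂'' (U j) 0 (R 0 j) (R 2 j))
    (h₃ : Inserts N T₃ T₃' (U j) 0 (j + 1) (R 3 j))
    (h₃' : Inserts N T₃' T₃'' (V j) 0 (j + 1) (R 4 j)) :
    History N U V R (j + 1) T₁' T₂'' T₃'' where
  rel₁ θ hθ := by
    rw [h₁.rel_eq, h.rel₁ θ hθ, edgeRel, edgeRel, Setoid.eqvGen_sup]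
    congr 1
    funext a b
    simp only [Nat.lt_succ_iff_lt_or_eq, or_and_right, exists_or, exists_eq_left]
  rel₂ θ hθ := by
    rw [h₂'.rel_eq, h₂.rel_eq, h.rel₂ θ hθ, loopRel, loopRel, Setoid.eqvGen_sup,
      Setoid.eqvGen_sup]
    congr 1
    funext a b
    simp only [Nat.lt_succ_iff_lt_or_eq, or_and_right, exists_or, exists_eq_left, and_or_left,
      or_assoc]
    exact propext (or_congr_right or_left_comm)
  rel₃ θ hθ := by
    rw [h₃'.rel_eq, h₃.rel_eq, h.rel₃ θ hθ, touchRel, touchRel, Setoid.eqvGen_sup,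
      Setoid.eqvGen_sup]
    congr 1
    funext a b
    simp only [Nat.lt_succ_iff_lt_or_eq, or_and_right, exists_or, exists_eq_left, or_assoc]
  le_iff k hk θ hθ := by
    rcases Nat.lt_succ_iff_lt_or_eq.1 hk with hk | rfl
    · exact h.le_iff k hk θ hθ
    · rw [h₁.le_iff, h.rel₁ θ hθ]
  le_succ t ht k hk := by
    rcases Nat.lt_succ_iff_lt_or_eq.1 hk with hk | rfl
    · exact h.le_succ t ht k hk
    · have := le_of_inserts h₁
      have := le_of_inserts h₂
      have := le_of_inserts h₂'
      have := le_of_inserts h₃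
      have := le_of_inserts h₃'
      interval_cases t <;> omega
  count₁ θ hθ := by
    have := h.count₁ θ hθ
    have := h₁.heavyCount_eq θ
    simp only [countGE_succ]
    omega
  count₂ θ hθ := by
    have := h.count₂ θ hθ
    have := h₂.heavyCount_eq θ
    have := h₂'.heavyCount_eq θ
    simp only [countGE_succ]
    omega
  count₃ θ hθ := by
    have := h.count₃ θ hθ
    have := h₃.heavyCount_eq θ
    have := h₃'.heavyCount_eq θ
    simp only [countGE_succ]
    omega

end History

/-! ## The program -/

namespace RAM

open BottleneckTree

attribute [local simp] Expr.Fits Expr.val Expr.cost Cond.Fits Cond.Holds Cond.cost Memory.setReg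
  Memory.setArr Function.update_apply

/-- The memory `τ` arises from `σ` by the insertion of an edge into the tree at `a`, and the weight
of the superfluous edge, plus one, is stored in the array `y` in the cell given by register `2`. -/
structure Recorded (N B a y : ℕ) (σ τ : Memory) (u v c r : ℕ) : Prop where
  reg_eq : ∀ x < 6, τ.reg x = σ.reg x
  arr_eq : ∀ b, b < a ∨ a + 2 < b → b ≠ y → τ.arr b = σ.arr b
  arr_self : τ.arr y = Function.update (σ.arr y) (σ.reg 2) (r + 1)
  wf : (treeAt a τ).WF N B
  inserts : Inserts N (treeAt a σ) (treeAt a τ) u v c r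

theorem Recorded.treeAt_eq {N B a y b : ℕ} {σ τ : Memory} {u v c r : ℕ}
    (h : Recorded N B a y σ τ u v c r) (hb : b + 2 < a ∨ a + 2 < b) (hy : b + 2 < y) :
    treeAt b τ = treeAt b σ := by
  simp only [treeAt, h.arr_eq b (by omega) (by omega), h.arr_eq (b + 1) (by omega) (by omega),
    h.arr_eq (b + 2) (by omega) (by omega)]

theorem ensures_assign_frame {W S : ℕ} {σ : Memory} (x : ℕ) {e : Expr} (he : e.Fits W S σ) :
    Ensures W S (.assign x e) σ fun t τ => t = e.cost + 1 ∧ τ.reg x = e.val σ ∧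
      (∀ r, r ≠ x → τ.reg r = σ.reg r) ∧ τ.arr = σ.arr :=
  ensures_assign he ⟨rfl, by simp, fun r hr => by simp [hr], rfl⟩

theorem ensures_store_frame {W S : ℕ} {σ : Memory} (a : ℕ) {i e : Expr}
    (hi : i.Fits W S σ) (hk : i.val σ < S) (he : e.Fits W S σ) :
    Ensures W S (.store a i e) σ fun t τ => t = i.cost + e.cost + 1 ∧
      τ.arr a = Function.update (σ.arr a) (i.val σ) (e.val σ) ∧
      (∀ b, b ≠ a → τ.arr b = σ.arr b) ∧ τ.reg = σ.reg :=
  ensures_store hi hk he ⟨rfl, by simp, fun b hb => by simp [hb], rfl⟩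

theorem treeAt_congr {σ τ : Memory} (h : τ.arr = σ.arr) (a : ℕ) : treeAt a τ = treeAt a σ := by
  simp only [treeAt, h]

def recordProgram (y : ℕ) : Program := .store y (.reg 2) (.add (.reg 6) (.lit 1))

theorem ensures_record {W S N B a y u v c L : ℕ} {σ : Memory} {p : Program}
    (hW : 4 * N + B + 10 < W) (hy : a + 2 < y) (hj : σ.reg 2 < S) (hj' : σ.reg 2 ≤ B) (hc : c ≤ B)
    (h : Ensures W S p σ fun t τ =>
      t + 200 * (treeAt a τ).potential N ≤ 200 * (treeAt a σ).potential N + L ∧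
      (treeAt a τ).WF N B ∧ Inserts N (treeAt a σ) (treeAt a τ) u v c (τ.reg 6) ∧
      Frame a 6 13 σ τ) :
    Ensures W S (.seq p (recordProgram y)) σ fun t τ =>
      t + 200 * (treeAt a τ).potential N ≤ 200 * (treeAt a σ).potential N + L + 10 ∧
      ∃ r, Recorded N B a y σ τ u v c r := by
  refine ensures_seq (h.mono ?_)
  rintro t τ ⟨ht, hwf, hins, hf⟩
  have h2 := hf.reg_eq 2 (by omega)
  have h6 := History.le_of_inserts hins
  refine ensures_store (by simp [h2]; omega) (by simpa [h2] using hj) (by simp; omega) ?_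
  have htree : treeAt a (τ.setArr y ((Expr.reg 2).val τ) (((Expr.reg 6).add (.lit 1)).val τ)) =
      treeAt a τ := by
    simp [treeAt, show a ≠ y by omega, show a + 1 ≠ y by omega, show a + 2 ≠ y by omega]
  rw [htree]
  refine ⟨by simp; omega, τ.reg 6, fun x hx => hf.reg_eq x (by omega), fun b hb hby => ?_, ?_,
    htree.symm ▸ hwf, htree.symm ▸ hins⟩
  · simp only [Memory.setArr, Function.update_of_ne hby]
    exact hf.arr_eq b hb
  · simp [h2, hf.arr_eq y (by omega)]

/-- The insertion of the edge in register `2` into the three trees. -/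
def roundProgram : Program :=
  .seq (.assign 3 (.add (.get 0 (.reg 2)) (.lit 1))) <|
  .seq (.assign 4 (.add (.get 1 (.reg 2)) (.lit 1))) <|
  .seq (.assign 5 (.add (.reg 2) (.lit 1))) <|
  .seq (.seq (insertEdgeProgram 2) (recordProgram 12)) <|
  .seq (.seq (insertEdgeProgram 5) (recordProgram 13)) <|
  -- The edge to the root in the second tree has the weight that became superfluous in the first
  -- tree, which was stored plus one.
  .seq (.assign 5 (.sub (.get 12 (.reg 2)) (.lit 1))) <|
  .seq (.seq (insertStarProgram 5) (recordProgram 14)) <|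
  .seq (.assign 5 (.add (.reg 2) (.lit 1))) <|
  .seq (.seq (insertStarProgram 8) (recordProgram 15)) <|
  .seq (.assign 3 (.reg 4)) <|
  .seq (.seq (insertStarProgram 8) (recordProgram 16)) <|
  -- A superfluous weight is at most `k + 1` and is stored plus one, so the coordinate `k + 2`
  -- guarantees `y ≤ x`.
  .seq (.store 11 (.reg 2) (.add (.reg 2) (.lit 2)))
    (.assign 2 (.add (.reg 2) (.lit 1)))

def mainProgram : Program := .while (.lt (.reg 2) (.reg 1)) roundProgram

/-- The weights of the superfluous edges that are stored in memory. -/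
def removed (σ : Memory) (t k : ℕ) : ℕ := σ.arr (12 + t) k - 1

/-- The total potential of the three trees. -/
def totalPotential (N : ℕ) (σ : Memory) : ℕ :=
  (treeAt 2 σ).potential N + (treeAt 5 σ).potential N + (treeAt 8 σ).potential N

/-- The three trees have processed the edges before the one in register `2`. -/
structure RoundInvariant (N M : ℕ) (U V : ℕ → ℕ) (σ : Memory) : Prop where
  reg_one : σ.reg 1 = M
  reg_two : σ.reg 2 ≤ M
  arr_zero : ∀ k < M, σ.arr 0 k + 1 = U k
  arr_one : ∀ k < M, σ.arr 1 k + 1 = V k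
  wf₁ : (treeAt 2 σ).WF N M
  wf₂ : (treeAt 5 σ).WF N M
  wf₃ : (treeAt 8 σ).WF N M
  history : History N U V (removed σ) (σ.reg 2) (treeAt 2 σ) (treeAt 5 σ) (treeAt 8 σ)
  arr_x : ∀ k < σ.reg 2, σ.arr 11 k = k + 2
  arr_y : ∀ t < 5, ∀ k < σ.reg 2, 1 ≤ σ.arr (12 + t) k

/-- Five insertions cost `2000 * (log N + 1) + 10` each, up to changes of the potentials. Entries
recorded in earlier rounds are not touched. -/
theorem ensures_roundProgram {W S N M : ℕ} {U V : ℕ → ℕ} {σ : Memory}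
    (hW : 4 * N + M + 10 < W) (hS : N + M < S) (hU : ∀ k < M, U k ∈ Finset.Icc 1 N)
    (hV : ∀ k < M, V k ∈ Finset.Icc 1 N) (h : RoundInvariant N M U V σ) (hj : σ.reg 2 < M) :
    Ensures W S roundProgram σ fun t τ =>
      t + 200 * totalPotential N τ ≤ 200 * totalPotential N σ + 11000 * (Nat.log 2 N + 1) ∧
      RoundInvariant N M U V τ ∧ τ.reg 2 = σ.reg 2 + 1 ∧
      ∀ t < 5, ∀ k < σ.reg 2, removed τ t k = removed σ t k := by
  obtain ⟨j, hjj⟩ : ∃ j, σ.reg 2 = j := ⟨_, rfl⟩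
  rw [hjj] at hj ⊢
  have hUj := h.arr_zero j hj
  have hVj := h.arr_one j hj
  have hUm := hU j hj
  have hVm := hV j hj
  have hUN := Finset.mem_Icc.1 hUm
  have hVN := Finset.mem_Icc.1 hVm
  have hjS : j < S := by omega
  have hNS : N < S := by omega
  have hjM : j ≤ M := hj.le
  have hjM' : j + 1 ≤ M := hj
  have hjW : j < W := by omega
  have hjW' : j + 1 < W := by omega
  have hjW'' : j + 2 < W := by omega
  have hMW : ∀ x ≤ M, x + 1 < W := by omega
  have hVW : V j < W := by omega
  have hW1 : 1 < W := by omega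
  have hW2 : 2 < W := by omega
  obtain ⟨dρ₁, ρ₁, runρ₁, wρ₁, a1, b1, c1⟩ := ensures_assign_frame (W := W) (S := S)
    (σ := σ) 3 (e := .add (.get 0 (.reg 2)) (.lit 1)) (by simp [hjj, hjW, hjS, hUj, hW1]; omega)
  have hjj1 : ρ₁.reg 2 = j := by rw [b1 2 (by decide), hjj]
  obtain ⟨dρ₂, ρ₂, runρ₂, wρ₂, a2, b2, c2⟩ := ensures_assign_frame (W := W) (S := S)
    (σ := ρ₁) 4 (e := .add (.get 1 (.reg 2)) (.lit 1)) (by simp [hjj1, c1]; omega)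
  have hjj2 : ρ₂.reg 2 = j := by rw [b2 2 (by decide), hjj1]
  obtain ⟨dσ₁, σ₁, runσ₁, wσ₁, a3, b3, c3⟩ := ensures_assign_frame (W := W) (S := S)
    (σ := ρ₂) 5 (e := .add (.reg 2) (.lit 1)) (by simp [hjj2]; omega)
  have e2 : σ₁.reg 2 = j := by rw [b3 2 (by decide), hjj2]
  have e3 : σ₁.reg 3 = U j := by
    rw [b3 3 (by decide), b2 3 (by decide), a1, ← hUj, ← hjj]
    rfl
  have e4 : σ₁.reg 4 = V j := by
    rw [b3 4 (by decide), a2, ← hVj, ← hjj1, ← c1]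
    rfl
  have e5 : σ₁.reg 5 = j + 1 := by
    rw [a3, ← hjj2]
    rfl
  have ea : σ₁.arr = σ.arr := (c3.trans c2).trans c1
  have er : σ₁.reg 1 = σ.reg 1 := by rw [b3 1 (by decide), b2 1 (by decide), b1 1 (by decide)]
  have et := treeAt_congr ea
  obtain ⟨t₂, σ₂, runσ₂, ht₂, r₁, hr₁⟩ := ensures_record (S := S) (N := N) (B := M) (y := 12) (c := σ₁.reg 5) (a := 2) hW (by decide) (by rw [e2]; exact hjS)
    (by rw [e2]; exact hjM) (by rw [e5]; exact hjM') (ensures_insertEdgeProgram hW hNS (et 2 ▸ h.wf₁) (e3 ▸ hUm) (e4 ▸ hVm)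
      (by rw [e5]; exact hjM'))
  rw [e3, e4, e5] at hr₁
  have f2 : σ₂.reg 2 = j := (hr₁.reg_eq 2 (by decide)).trans e2
  have f3 : σ₂.reg 3 = U j := (hr₁.reg_eq 3 (by decide)).trans e3
  have f4 : σ₂.reg 4 = V j := (hr₁.reg_eq 4 (by decide)).trans e4
  have f5 : σ₂.reg 5 = j + 1 := (hr₁.reg_eq 5 (by decide)).trans e5
  have ft5 : treeAt 5 σ₂ = treeAt 5 σ := (hr₁.treeAt_eq (by decide) (by decide)).trans (et 5)
  obtain ⟨t₃, σ₃, runσ₃, ht₃, r₂, hr₂⟩ := ensures_record (S := S) (N := N) (B := M) (y := 13) (c := σ₂.reg 5) (a := 5) hW (by decide) (by rw [f2]; exact hjS)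
    (by rw [f2]; exact hjM) (by rw [f5]; exact hjM') (ensures_insertEdgeProgram hW hNS (ft5 ▸ h.wf₂) (f3 ▸ hUm) (f4 ▸ hVm)
      (by rw [f5]; exact hjM'))
  rw [f3, f4, f5] at hr₂
  have g2 : σ₃.reg 2 = j := (hr₂.reg_eq 2 (by decide)).trans f2
  have g12 : σ₃.arr 12 j = r₁ + 1 := by
    rw [hr₂.arr_eq 12 (by decide) (by decide), hr₁.arr_self, e2, Function.update_self]
  have hr₁' := History.le_of_inserts hr₁.inserts
  obtain ⟨dσ₄, σ₄, runσ₄, wσ₄, a4, b4, ia⟩ := ensures_assign_frame (W := W) (S := S)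
    (σ := σ₃) 5 (e := .sub (.get 12 (.reg 2)) (.lit 1)) (by simp [g2, g12, hjW, hjS, hW1, hMW r₁ (hr₁'.trans hjM')])
  have i2 : σ₄.reg 2 = j := by rw [b4 2 (by decide), g2]
  have i3 : σ₄.reg 3 = U j := by rw [b4 3 (by decide), hr₂.reg_eq 3 (by decide), f3]
  have i4 : σ₄.reg 4 = V j := by rw [b4 4 (by decide), hr₂.reg_eq 4 (by decide), f4]
  have i5 : σ₄.reg 5 = r₁ := by simp [a4, g2, g12]
  have i1 : σ₄.reg 1 = σ.reg 1 := by
    rw [b4 1 (by decide), hr₂.reg_eq 1 (by decide), hr₁.reg_eq 1 (by decide), er]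
  have it := treeAt_congr ia
  obtain ⟨t₅, σ₅, runσ₅, ht₅, r₃, hr₃⟩ := ensures_record (S := S) (N := N) (B := M) (y := 14) (c := σ₄.reg 5) (a := 5) hW (by decide) (by rw [i2]; exact hjS)
    (by rw [i2]; exact hjM) (by rw [i5]; exact (hr₁'.trans hjM')) (ensures_insertStarProgram hW hNS (it 5 ▸ hr₂.wf) (i3 ▸ hUm)
      (by rw [i5]; exact (hr₁'.trans hjM')))
  rw [i3, i5] at hr₃
  have k2 : σ₅.reg 2 = j := (hr₃.reg_eq 2 (by decide)).trans i2
  obtain ⟨dσ₆, σ₆, runσ₆, wσ₆, a6, b6, la⟩ := ensures_assign_frame (W := W) (S := S)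
    (σ := σ₅) 5 (e := .add (.reg 2) (.lit 1)) (by simp [k2, hjW, hjW', hW1])
  have l1 : σ₆.reg 1 = σ.reg 1 := by rw [b6 1 (by decide), hr₃.reg_eq 1 (by decide), i1]
  have l2 : σ₆.reg 2 = j := by rw [b6 2 (by decide), k2]
  have l3 : σ₆.reg 3 = U j := by rw [b6 3 (by decide), hr₃.reg_eq 3 (by decide), i3]
  have l4 : σ₆.reg 4 = V j := by rw [b6 4 (by decide), hr₃.reg_eq 4 (by decide), i4]
  have l5 : σ₆.reg 5 = j + 1 := by simp [a6, k2]
  have lt := treeAt_congr la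
  have lt8 : treeAt 8 σ₆ = treeAt 8 σ := by
    rw [lt, hr₃.treeAt_eq (by decide) (by decide), it, hr₂.treeAt_eq (by decide) (by decide),
      hr₁.treeAt_eq (by decide) (by decide), et]
  obtain ⟨t₇, σ₇, runσ₇, ht₇, r₄, hr₄⟩ := ensures_record (S := S) (N := N) (B := M) (y := 15) (c := σ₆.reg 5) (a := 8) hW (by decide) (by rw [l2]; exact hjS)
    (by rw [l2]; exact hjM) (by rw [l5]; exact hjM') (ensures_insertStarProgram hW hNS (lt8 ▸ h.wf₃) (l3 ▸ hUm)
      (by rw [l5]; exact hjM'))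
  rw [l3, l5] at hr₄
  have m4 : σ₇.reg 4 = V j := (hr₄.reg_eq 4 (by decide)).trans l4
  obtain ⟨dσ₈, σ₈, runσ₈, wσ₈, a8, b8, na⟩ := ensures_assign_frame (W := W) (S := S)
    (σ := σ₇) 3 (e := .reg 4) (by simp [m4, hVW])
  have n1 : σ₈.reg 1 = σ.reg 1 := by rw [b8 1 (by decide), hr₄.reg_eq 1 (by decide), l1]
  have n2 : σ₈.reg 2 = j := by rw [b8 2 (by decide), hr₄.reg_eq 2 (by decide), l2]
  have n3 : σ₈.reg 3 = V j := by simp [a8, m4]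
  have n5 : σ₈.reg 5 = j + 1 := by rw [b8 5 (by decide), hr₄.reg_eq 5 (by decide), l5]
  have nt := treeAt_congr na
  obtain ⟨t₉, σ₉, runσ₉, ht₉, r₅, hr₅⟩ := ensures_record (S := S) (N := N) (B := M) (y := 16) (c := σ₈.reg 5) (a := 8) hW (by decide) (by rw [n2]; exact hjS)
    (by rw [n2]; exact hjM) (by rw [n5]; exact hjM') (ensures_insertStarProgram hW hNS (nt 8 ▸ hr₄.wf) (n3 ▸ hVm)
      (by rw [n5]; exact hjM'))
  rw [n3, n5] at hr₅
  have o1 : σ₉.reg 1 = σ.reg 1 := (hr₅.reg_eq 1 (by decide)).trans n1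
  have o2 : σ₉.reg 2 = j := (hr₅.reg_eq 2 (by decide)).trans n2
  obtain ⟨dρ₃, ρ₃, runρ₃, wρ₃, a9, b9, c9⟩ := ensures_store_frame (W := W) (S := S) (σ := σ₉) 11
    (i := .reg 2) (e := .add (.reg 2) (.lit 2)) (by simp [o2, hjW]) (by simp [o2, hjS])
    (by simp [o2, hjW, hjW'', hW2])
  obtain ⟨dτ, τ, runτ, wτ, a0, b0, c0⟩ := ensures_assign_frame (W := W) (S := S)
    (σ := ρ₃) 2 (e := .add (.reg 2) (.lit 1)) (by simp [o2, c9, hjW, hjW', hW1])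
  have q1 : τ.reg 1 = σ.reg 1 := by rw [b0 1 (by decide), c9, o1]
  have q2 : τ.reg 2 = j + 1 := by simp [a0, c9, o2]
  have q11 : τ.arr 11 = Function.update (σ₉.arr 11) j (j + 2) := by
    rw [c0, a9, ← o2]
    rfl
  have qa : ∀ b, b ≠ 11 → τ.arr b = σ₉.arr b := fun b hb => by rw [c0, b9 b hb]
  have x0 : τ.arr 0 = σ.arr 0 := by
    rw [qa 0 (by decide), hr₅.arr_eq 0 (by decide) (by decide), na,
      hr₄.arr_eq 0 (by decide) (by decide), la, hr₃.arr_eq 0 (by decide) (by decide), ia,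
      hr₂.arr_eq 0 (by decide) (by decide), hr₁.arr_eq 0 (by decide) (by decide), ea]
  have x1 : τ.arr 1 = σ.arr 1 := by
    rw [qa 1 (by decide), hr₅.arr_eq 1 (by decide) (by decide), na,
      hr₄.arr_eq 1 (by decide) (by decide), la, hr₃.arr_eq 1 (by decide) (by decide), ia,
      hr₂.arr_eq 1 (by decide) (by decide), hr₁.arr_eq 1 (by decide) (by decide), ea]
  have x11 : τ.arr 11 = Function.update (σ.arr 11) j (j + 2) := by
    rw [q11, hr₅.arr_eq 11 (by decide) (by decide), na,
      hr₄.arr_eq 11 (by decide) (by decide), la, hr₃.arr_eq 11 (by decide) (by decide), ia,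
      hr₂.arr_eq 11 (by decide) (by decide), hr₁.arr_eq 11 (by decide) (by decide), ea]
  have y0 : τ.arr 12 = Function.update (σ.arr 12) j (r₁ + 1) := by
    rw [qa 12 (by decide), hr₅.arr_eq 12 (by decide) (by decide), na,
      hr₄.arr_eq 12 (by decide) (by decide), la, hr₃.arr_eq 12 (by decide) (by decide), ia,
      hr₂.arr_eq 12 (by decide) (by decide), hr₁.arr_self, ea, e2]
  have y1 : τ.arr 13 = Function.update (σ.arr 13) j (r₂ + 1) := by
    rw [qa 13 (by decide), hr₅.arr_eq 13 (by decide) (by decide), na,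
      hr₄.arr_eq 13 (by decide) (by decide), la, hr₃.arr_eq 13 (by decide) (by decide), ia,
      hr₂.arr_self, hr₁.arr_eq 13 (by decide) (by decide), ea, f2]
  have y2 : τ.arr 14 = Function.update (σ.arr 14) j (r₃ + 1) := by
    rw [qa 14 (by decide), hr₅.arr_eq 14 (by decide) (by decide), na,
      hr₄.arr_eq 14 (by decide) (by decide), la, hr₃.arr_self, ia,
      hr₂.arr_eq 14 (by decide) (by decide), hr₁.arr_eq 14 (by decide) (by decide), ea, i2]
  have y3 : τ.arr 15 = Function.update (σ.arr 15) j (r₄ + 1) := by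
    rw [qa 15 (by decide), hr₅.arr_eq 15 (by decide) (by decide), na, hr₄.arr_self, la,
      hr₃.arr_eq 15 (by decide) (by decide), ia, hr₂.arr_eq 15 (by decide) (by decide),
      hr₁.arr_eq 15 (by decide) (by decide), ea, l2]
  have y4 : τ.arr 16 = Function.update (σ.arr 16) j (r₅ + 1) := by
    rw [qa 16 (by decide), hr₅.arr_self, na, hr₄.arr_eq 16 (by decide) (by decide), la,
      hr₃.arr_eq 16 (by decide) (by decide), ia, hr₂.arr_eq 16 (by decide) (by decide),
      hr₁.arr_eq 16 (by decide) (by decide), ea, n2]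
  have hy : ∀ t < 5, ∃ r, τ.arr (12 + t) = Function.update (σ.arr (12 + t)) j (r + 1) := by
    intro t ht
    interval_cases t
    exacts [⟨_, y0⟩, ⟨_, y1⟩, ⟨_, y2⟩, ⟨_, y3⟩, ⟨_, y4⟩]
  have hrem : ∀ t < 5, ∀ k < j, removed τ t k = removed σ t k := by
    intro t ht k hk
    obtain ⟨r, hr⟩ := hy t ht
    rw [removed, hr, Function.update_of_ne hk.ne, removed]
  have qt : ∀ a, a ≠ 11 ∧ a + 1 ≠ 11 ∧ a + 2 ≠ 11 → treeAt a τ = treeAt a σ₉ := fun a ha => by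
    simp only [treeAt, qa a ha.1, qa (a + 1) ha.2.1, qa (a + 2) ha.2.2]
  have t2 : treeAt 2 τ = treeAt 2 σ₂ := by
    rw [qt 2 (by decide), hr₅.treeAt_eq (by decide) (by decide), nt,
      hr₄.treeAt_eq (by decide) (by decide), lt, hr₃.treeAt_eq (by decide) (by decide), it,
      hr₂.treeAt_eq (by decide) (by decide)]
  have t5 : treeAt 5 τ = treeAt 5 σ₅ := by
    rw [qt 5 (by decide), hr₅.treeAt_eq (by decide) (by decide), nt,
      hr₄.treeAt_eq (by decide) (by decide), lt]
  have t8 : treeAt 8 τ = treeAt 8 σ₉ := qt 8 (by decide)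
  have s0 : removed τ 0 j = r₁ := by simp [removed, y0]
  have s1 : removed τ 1 j = r₂ := by simp [removed, y1]
  have s2 : removed τ 2 j = r₃ := by simp [removed, y2]
  have s3 : removed τ 3 j = r₄ := by simp [removed, y3]
  have s4 : removed τ 4 j = r₅ := by simp [removed, y4]
  rw [et] at ht₂
  rw [ft5] at ht₃
  rw [it] at ht₅
  rw [lt8] at ht₇
  rw [nt] at ht₉
  refine ⟨_, τ, .seq runρ₁ <| .seq runρ₂ <| .seq runσ₁ <| .seq runσ₂ <| .seq runσ₃ <|
    .seq runσ₄ <| .seq runσ₅ <| .seq runσ₆ <| .seq runσ₇ <| .seq runσ₈ <| .seq runσ₉ <|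
    .seq runρ₃ runτ, ?_⟩
  refine ⟨?_, ⟨q1.trans h.reg_one, q2 ▸ hj, fun k hk => ?_, fun k hk => ?_, t2 ▸ hr₁.wf,
    t5 ▸ hr₃.wf, t8 ▸ hr₅.wf, ?_, fun k hk => ?_, fun t ht k hk => ?_⟩, q2, hrem⟩
  · simp only [totalPotential, t2, t5, t8]
    simp only [Expr.cost] at wρ₁ wρ₂ wσ₁ wσ₄ wσ₆ wσ₈ wρ₃ wτ
    clear a1 a2 a3 a4 a6 a8 a9 a0 s0 s1 s2 s3 s4
    omega
  · rw [x0, h.arr_zero k hk]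
  · rw [x1, h.arr_one k hk]
  · have hh := (hjj ▸ h.history).congr (R' := removed τ) fun t ht k hk => (hrem t ht k hk).symm
    rw [q2, t2, t5, t8]
    refine hh.succ (T₂' := treeAt 5 σ₃) (T₃' := treeAt 8 σ₇) ?_ ?_ ?_ ?_ ?_
    · rw [s0, ← et 2]
      exact hr₁.inserts
    · rw [s1, ← ft5]
      exact hr₂.inserts
    · rw [s0, s2, ← it]
      exact hr₃.inserts
    · rw [s3, ← lt8]
      exact hr₄.inserts
    · rw [s4, ← nt]
      exact hr₅.inserts
  · rw [x11, Function.update_apply]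
    split_ifs with hkj
    · rw [hkj]
    · exact h.arr_x k (hjj ▸ Nat.lt_of_le_of_ne (Nat.lt_succ_iff.1 (hk.trans_eq q2)) hkj)
  · obtain ⟨r, hr⟩ := hy t ht
    rw [hr, Function.update_apply]
    split_ifs with hkj
    · exact Nat.le_add_left _ _
    · exact h.arr_y t ht k (hjj ▸ Nat.lt_of_le_of_ne (Nat.lt_succ_iff.1 (hk.trans_eq q2)) hkj)

/-- The memory in which the program halts. -/
structure Final (N M : ℕ) (U V : ℕ → ℕ) (σ : Memory) : Prop where
  reg_one : σ.reg 1 = M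
  arr_x : ∀ k < M, σ.arr 11 k = k + 2
  arr_y : ∀ t < 5, ∀ k < M, 1 ≤ σ.arr (12 + t) k
  -- The earlier trees have been overwritten, but only their existence matters: the weights recorded
  -- before time `j` are still those in memory.
  history : ∀ j ≤ M, ∃ T₁ T₂ T₃ : BottleneckTree, T₁.WF N M ∧ T₂.WF N M ∧ T₃.WF N M ∧
    History N U V (removed σ) j T₁ T₂ T₃

theorem ensures_mainProgram {W S N M : ℕ} {U V : ℕ → ℕ} {σ : Memory}
    (hW : 4 * N + M + 10 < W) (hS : N + M < S) (hU : ∀ k < M, U k ∈ Finset.Icc 1 N)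
    (hV : ∀ k < M, V k ∈ Finset.Icc 1 N) (h : RoundInvariant N M U V σ) (hj : σ.reg 2 = 0) :
    Ensures W S mainProgram σ fun t τ =>
      t ≤ 200 * totalPotential N σ + 11010 * (M * (Nat.log 2 N + 1)) + 10 ∧
      Final N M U V τ := by
  refine (ensures_while (fun τ => RoundInvariant N M U V τ ∧
      ∀ j ≤ τ.reg 2, ∃ T₁ T₂ T₃ : BottleneckTree, T₁.WF N M ∧ T₂.WF N M ∧ T₃.WF N M ∧
        History N U V (removed τ) j T₁ T₂ T₃)
    (fun τ => 200 * totalPotential N τ + 11010 * ((M - τ.reg 2) * (Nat.log 2 N + 1)))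
    ?_ ?_ ?_).mono ?_
  · rintro τ ⟨hτ, -⟩
    have := hτ.reg_one
    have := hτ.reg_two
    simp
    omega
  · rintro τ ⟨hτ, hh⟩ hb
    have hlt : τ.reg 2 < M := by simpa [hτ.reg_one] using hb
    refine (ensures_roundProgram hW hS hU hV hτ hlt).mono ?_
    rintro t τ' ⟨ht, hτ', h2, hrem⟩
    refine ⟨⟨hτ', fun j hj => ?_⟩, ?_⟩
    · rcases Nat.lt_or_ge (τ.reg 2) j with hj' | hj'
      · obtain rfl : j = τ'.reg 2 := by omega
        exact ⟨_, _, _, hτ'.wf₁, hτ'.wf₂, hτ'.wf₃, hτ'.history⟩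
      · obtain ⟨T₁, T₂, T₃, w₁, w₂, w₃, hist⟩ := hh j hj'
        exact ⟨T₁, T₂, T₃, w₁, w₂, w₃, hist.congr fun t ht k hk => (hrem t ht k (by omega)).symm⟩
    · have : M - τ.reg 2 = (M - τ'.reg 2) + 1 := by omega
      rw [this, add_mul, one_mul]
      simp
      omega
  · refine ⟨h, fun j hj' => ?_⟩
    obtain rfl : j = σ.reg 2 := by omega
    exact ⟨_, _, _, h.wf₁, h.wf₂, h.wf₃, h.history⟩
  · rintro t τ ⟨⟨hτ, hh⟩, hb, ht⟩
    have hM : τ.reg 2 = M := by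
      have := hτ.reg_two
      have : M ≤ τ.reg 2 := by simpa [hτ.reg_one] using hb
      omega
    refine ⟨?_, hτ.reg_one, hM ▸ hτ.arr_x, hM ▸ hτ.arr_y, hM ▸ hh⟩
    rw [hj, Nat.sub_zero] at ht
    simp at ht
    omega

/-- Zeroed memory already encodes the initial tree, a star around the root with weights `0`. No
initialization is needed, so no term linear in `n` enters the time. -/
theorem wf_zero {N B : ℕ} {T : BottleneckTree} (hp : ∀ x, T.p x = 0) (hw : ∀ x, T.w x = 0)
    (hs : ∀ x, T.s x = 0) : T.WF N B := by
  refine ⟨fun x _ => by simp [hp], fun x _ => by simp [hw], fun x hx => ?_, fun x hx => ?_⟩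
  · have := Finset.mem_Icc.1 hx
    rw [hs]
    omega
  · rw [hs]
    refine (Finset.sum_eq_zero fun y _ => if_neg ?_).symm
    have := Finset.mem_Icc.1 hx
    rw [hp]
    omega

theorem exists_run_mainProgram (G : RelationalEventGraph) (U V : ℕ → ℕ)
    (hU : ∀ k (h : k < G.m), U k = (G.edge ⟨k, h⟩).1 + 1)
    (hV : ∀ k (h : k < G.m), V k = (G.edge ⟨k, h⟩).2 + 1) :
    ∃ t σ, Run (12000 * (G.n + G.m + 1)) (12000 * (G.n + G.m + 1)) mainProgram (input G) t σ ∧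
      t ≤ 12000 * (G.m * (Nat.log 2 G.n + 1) + 1) ∧ Final G.n G.m U V σ := by
  have htree : ∀ a, 2 ≤ a → treeAt a (input G) = ⟨fun _ => 0, fun _ => 0, fun _ => 0⟩ := by
    intro a ha
    simp [treeAt, input, show a ≠ 0 by omega, show a ≠ 1 by omega]
  have hwf : ∀ a, 2 ≤ a → (treeAt a (input G)).WF G.n G.m := fun a ha => by
    rw [htree a ha]
    exact wf_zero (fun _ => rfl) (fun _ => rfl) (fun _ => rfl)
  have hpot : ∀ a, 2 ≤ a → (treeAt a (input G)).potential G.n = 0 := fun a ha => by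
    rw [htree a ha]
    simp [potential]
  have hw : ∀ a, 2 ≤ a → ∀ x, (treeAt a (input G)).w x = 0 := fun a ha x => by rw [htree a ha]
  have h2 : (input G).reg 2 = 0 := by simp [input]
  obtain ⟨t, σ, hr, ht, hf⟩ := ensures_mainProgram (W := 12000 * (G.n + G.m + 1))
    (S := 12000 * (G.n + G.m + 1)) (N := G.n) (M := G.m) (U := U) (V := V) (σ := input G)
    (by omega) (by omega)
    (fun k hk => by rw [hU k hk, Finset.mem_Icc]; have := (G.edge ⟨k, hk⟩).1.2; omega)
    (fun k hk => by rw [hV k hk, Finset.mem_Icc]; have := (G.edge ⟨k, hk⟩).2.2; omega)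
    ⟨by simp [input], by omega, fun k hk => by simp [input, hk, hU], fun k hk => by
      simp [input, hk, hV], hwf 2 (by omega), hwf 5 (by omega), hwf 8 (by omega),
      by rw [h2]; exact History.zero (hw 2 (by omega)) (hw 5 (by omega)) (hw 8 (by omega)),
      by rw [h2]; omega, by rw [h2]; omega⟩ h2
  refine ⟨t, σ, hr, ?_, hf⟩
  simp only [totalPotential, hpot 2 le_rfl, hpot 5 (by omega), hpot 8 (by omega)] at ht
  omega

end RAM

/-! ## Components of slices -/

namespace RelationalEventGraph

variable (G : RelationalEventGraph)

/-- The first endpoint of an edge, where the vertices are counted from one. -/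
def fst (k : ℕ) : ℕ := if h : k < G.m then ((G.edge ⟨k, h⟩).1 : ℕ) + 1 else 0

/-- The second endpoint of an edge, where the vertices are counted from one. -/
def snd (k : ℕ) : ℕ := if h : k < G.m then ((G.edge ⟨k, h⟩).2 : ℕ) + 1 else 0

variable {G} {i j : ℕ}

/-- A vertex as a vertex of a slice. -/
def toSlice (i j : ℕ) (x : Fin G.n) : (G.slice i j).vertexSet := ⟨x, Set.mem_univ x⟩

theorem toSlice_val (x : (G.slice i j).vertexSet) : toSlice i j (x : Fin G.n) = x := rfl

theorem fst_val (k : Fin G.m) : G.fst k = (G.edge k).1 + 1 := by simp [fst]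

theorem snd_val (k : Fin G.m) : G.snd k = (G.edge k).2 + 1 := by simp [snd]

theorem edge_eq_or_iff {k : Fin G.m} {x y : Fin G.n} :
    (G.edge k = (x, y) ∨ G.edge k = (y, x)) ↔
      (G.fst k = x + 1 ∧ G.snd k = y + 1) ∨ (G.fst k = y + 1 ∧ G.snd k = x + 1) := by
  simp only [fst_val, snd_val, Prod.ext_iff, Fin.ext_iff]
  omega

theorem component_eq_of_isLink {k : Fin G.m} {x y : (G.slice i j).vertexSet}
    (h : (G.slice i j).IsLink k x y) :
    (G.slice i j).toSimpleGraph.connectedComponentMk x =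
      (G.slice i j).toSimpleGraph.connectedComponentMk y := by
  by_cases hxy : x = y
  · rw [hxy]
  · exact SimpleGraph.ConnectedComponent.sound (SimpleGraph.Adj.reachable ⟨hxy, k, h⟩)

/-- The components of the edge relation are those of the slice. -/
theorem edgeRel_iff (hj : j < G.m) (x y : (G.slice i j).vertexSet) :
    edgeRel G.fst G.snd (j + 1) (i + 1) ((x : Fin G.n) + 1) ((y : Fin G.n) + 1) ↔
      (G.slice i j).toSimpleGraph.connectedComponentMk x =
        (G.slice i j).toSimpleGraph.connectedComponentMk y := by
  constructor
  · intro h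
    -- The component of a vertex, and `none` for numbers that are not vertices; it is constant along
    -- the generating edges.
    let q : ℕ → Option (G.slice i j).Component := fun a =>
      if h : 1 ≤ a ∧ a ≤ G.n then
        some ((G.slice i j).toSimpleGraph.connectedComponentMk (toSlice i j ⟨a - 1, by omega⟩))
      else none
    have hq : ∀ x : Fin G.n, q (x + 1) =
        some ((G.slice i j).toSimpleGraph.connectedComponentMk (toSlice i j x)) := fun x => by
      have := x.2
      simp only [q]
      rw [dif_pos ⟨by omega, by omega⟩]
      rfl
    have hle : edgeRel G.fst G.snd (j + 1) (i + 1) ≤ Setoid.ker q := by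
      refine Setoid.eqvGen_le ?_
      rintro _ _ ⟨k, hk, rfl, rfl, hki⟩
      have hkm : k < G.m := by omega
      rw [Setoid.ker_def, show k = ((⟨k, hkm⟩ : Fin G.m) : ℕ) from rfl, fst_val, snd_val, hq, hq]
      exact congrArg some (component_eq_of_isLink (k := ⟨k, hkm⟩)
        ⟨⟨by simp; omega, by simp; omega⟩, .inl rfl⟩)
    have := hle h
    rw [Setoid.ker_def, hq, hq] at this
    exact Option.some_injective _ this
  · intro h
    obtain ⟨p⟩ := SimpleGraph.ConnectedComponent.exact h
    induction p with
    | nil => exact Setoid.refl' _ _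
    | cons hadj p ih =>
      refine Setoid.trans' _ ?_ (ih (SimpleGraph.ConnectedComponent.sound ⟨p⟩))
      obtain ⟨-, k, hk, he⟩ := hadj
      rcases edge_eq_or_iff.1 he with ⟨h1, h2⟩ | ⟨h1, h2⟩
      · rw [← h1, ← h2]
        exact .rel _ _ ⟨k, by omega, rfl, rfl, by omega⟩
      · rw [← h1, ← h2]
        exact .symm _ _ (.rel _ _ ⟨k, by omega, rfl, rfl, by omega⟩)

theorem edgeRel_mono {U V : ℕ → ℕ} {j j' θ : ℕ} (h : j ≤ j') :
    edgeRel U V j θ ≤ edgeRel U V j' θ :=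
  Setoid.eqvGen_mono fun _ _ ⟨k, hk, h'⟩ => ⟨k, by omega, h'⟩

/-! ### Cycles and edges whose ends are connected by earlier edges. -/

/-- An edge whose endpoints are connected by earlier edges closes a cycle. -/
theorem exists_cycle {k : Fin G.m} (hjm : j < G.m) (hi : i ≤ k) (hj : (k : ℕ) ≤ j)
    (h : edgeRel G.fst G.snd k (i + 1) (G.fst k) (G.snd k)) :
    (G.slice i j).IsLoopy
      ((G.slice i j).toSimpleGraph.connectedComponentMk (toSlice i j (G.edge k).1)) := by
  -- If `k = i`, the slice has no earlier edges and connection means equality, so in both cases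
  -- `e_k` is a loop.
  by_cases hik : (k : ℕ) = i ∨ (G.edge k).1 = (G.edge k).2
  · have he : (G.edge k).1 = (G.edge k).2 := by
      refine hik.elim (fun hik => ?_) id
      have hle : edgeRel G.fst G.snd k (i + 1) ≤ ⊥ := by
        refine Setoid.eqvGen_le ?_
        rintro _ _ ⟨k', hk', -, -, hk''⟩
        omega
      have := hle h
      rw [Setoid.bot_def, fst_val, snd_val] at this
      exact Fin.ext (by omega)
    refine ⟨0, fun _ => toSlice i j (G.edge k).1, fun _ => k, ⟨?_, ?_, fun t => ?_⟩, fun t => rfl⟩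
    · exact fun a b _ => Fin.ext (by omega)
    · exact fun a b _ => Fin.ext (by omega)
    · exact ⟨⟨hi, hj⟩, .inl (Prod.ext rfl he.symm)⟩
  push Not at hik
  obtain ⟨hik, hne⟩ := hik
  obtain ⟨k', hk'⟩ : ∃ k', (k : ℕ) = k' + 1 := ⟨k - 1, by omega⟩
  have hkm := k.2
  rw [hk', ← hk', fst_val, snd_val, hk'] at h
  have h' := (edgeRel_iff (j := k') (by omega) (toSlice i k' (G.edge k).1)
    (toSlice i k' (G.edge k).2)).1 h
  -- A path among the edges `e_i, …, e_{k-1}`, to be closed by `e_k`.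
  obtain ⟨p, hp⟩ := (SimpleGraph.ConnectedComponent.exact h').exists_isPath
  have hlink : ∀ t < p.length, ∃ e : Fin G.m, (G.slice i k').IsLink e (p.getVert t : Fin G.n)
      (p.getVert (t + 1) : Fin G.n) := fun t ht => (p.adj_getVert_succ ht).2
  have : Nonempty (Fin G.m) := ⟨k⟩
  choose! f hf using hlink
  have hinj : ∀ s t, s ≤ p.length → t ≤ p.length → p.getVert s = p.getVert t → s = t :=
    fun s t hs ht hst => hp.getVert_injOn hs ht hst
  have hlt : ∀ t < p.length, i ≤ (f t : ℕ) ∧ (f t : ℕ) < k := fun t ht => by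
    have := (hf t ht).1
    omega
  let e : Fin (p.length + 1) → Fin G.m := fun t => if (t : ℕ) < p.length then f t else k
  refine ⟨p.length, fun t => toSlice i j (p.getVert t), e, ⟨fun s t hst => ?_, fun s t hst => ?_,
    fun t => ?_⟩, fun t => ?_⟩
  · exact Fin.ext (hinj s t (by omega) (by omega) (Subtype.ext hst))
  · simp only [e] at hst
    split_ifs at hst with hs ht ht
    · have h1 := hf s hs
      have h2 := hf t ht
      rw [hst] at h1
      -- An edge used at two positions joins the same two vertices twice. On a path the positions
      -- then agree; traversal in opposite directions would need `s = t + 1` and `t = s + 1`.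
      rcases h1.eq_and_eq_or_eq_and_eq h2 with ⟨h3, -⟩ | ⟨h3, h4⟩
      · exact Fin.ext (hinj s t (by omega) (by omega) (Subtype.ext h3))
      · have h5 := hinj s (t + 1) (by omega) (by omega) (Subtype.ext h3)
        have h6 := hinj (s + 1) t (by omega) (by omega) (Subtype.ext h4)
        omega
    · have := hlt s hs
      rw [hst] at this
      omega
    · have := hlt t ht
      rw [← hst] at this
      omega
    · exact Fin.ext (by omega)
  · simp only [e]
    split_ifs with ht
    · have h1 : ((t + 1 : Fin (p.length + 1)) : ℕ) = t + 1 := Fin.val_add_one_of_lt' (by omega)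
      have h2 := hf t ht
      refine ⟨⟨h2.1.1, by have := hlt t ht; omega⟩, ?_⟩
      have h3 : ∀ s : Fin (p.length + 1), (s : ℕ) = t + 1 →
          (G.edge (f t) = ((p.getVert t : Fin G.n), (p.getVert s : Fin G.n)) ∨
            G.edge (f t) = ((p.getVert s : Fin G.n), (p.getVert t : Fin G.n))) := fun s hs => by
        rw [hs]
        exact h2.2
      exact h3 _ h1
    · obtain rfl : t = Fin.last p.length := Fin.ext (by simp; omega)
      refine ⟨⟨hi, hj⟩, .inr ?_⟩
      have h3 : ∀ s : Fin (p.length + 1), (s : ℕ) = 0 →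
          G.edge k = ((p.getVert s : Fin G.n), (p.getVert p.length : Fin G.n)) := fun s hs => by
        rw [hs, p.getVert_length, p.getVert_zero]
        rfl
      exact h3 _ (by rw [Fin.last_add_one]; rfl)
  · have h1 : (G.slice i k').toSimpleGraph.Reachable (toSlice i k' (G.edge k).1) (p.getVert t) :=
      ⟨p.take t⟩
    have h2 := (edgeRel_iff (by omega) _ _).2 (SimpleGraph.ConnectedComponent.sound h1)
    exact ((edgeRel_iff hjm (toSlice i j (G.edge k).1) (toSlice i j (p.getVert t))).1
      (edgeRel_mono (by omega) h2)).symm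

/-- Take the latest edge of the cycle: the rest of the cycle connects its ends by earlier edges of
the slice. -/
theorem exists_of_isLoopy {c : (G.slice i j).Component} (h : (G.slice i j).IsLoopy c) :
    ∃ k : Fin G.m, i ≤ k ∧ (k : ℕ) ≤ j ∧
      edgeRel G.fst G.snd k (i + 1) (G.fst k) (G.snd k) ∧
      (G.slice i j).toSimpleGraph.connectedComponentMk (toSlice i j (G.edge k).1) = c := by
  obtain ⟨l, v, e, hcyc, hc⟩ := h
  obtain ⟨t, ht⟩ := Finite.exists_max e
  obtain ⟨hi, hj⟩ := (hcyc.isLink t).1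
  -- The indices `t + 1 + s` modulo `l + 1`, for `s = 0, …, l`, go once around the cycle from the
  -- vertex after `t` back to `t`, without using the edge `e t`.
  have hmod : ∀ s, (t + 1 + s) % (l + 1) < l + 1 := fun s => Nat.mod_lt _ (by omega)
  have hne : ∀ s < l, (⟨_, hmod s⟩ : Fin (l + 1)) ≠ t := fun s hs hst => by
    have := congrArg Fin.val hst
    simp only at this
    rcases Nat.lt_or_ge (t + 1 + s) (l + 1) with h | h
    · rw [Nat.mod_eq_of_lt h] at this
      omega
    · rw [Nat.mod_eq_sub_mod h, Nat.mod_eq_of_lt (by omega)] at this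
      omega
  have hsucc : ∀ s, (⟨_, hmod s⟩ + 1 : Fin (l + 1)) = ⟨_, hmod (s + 1)⟩ := fun s => by
    apply Fin.ext
    simp only [Fin.val_add, Fin.coe_ofNat_eq_mod, Nat.mod_add_mod, Nat.add_mod_mod]
    rfl
  have hrel : ∀ (f : Fin G.m) (x y : Fin G.n), (G.slice i j).IsLink f x y → (f : ℕ) < e t →
      edgeRel G.fst G.snd (e t) (i + 1) (x + 1) (y + 1) := fun f x y hf hft => by
    have hfi := hf.1.1
    rcases edge_eq_or_iff.1 hf.2 with ⟨h1, h2⟩ | ⟨h1, h2⟩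
    · rw [← h1, ← h2]
      exact .rel _ _ ⟨f, hft, rfl, rfl, by omega⟩
    · rw [← h1, ← h2]
      exact .symm _ _ (.rel _ _ ⟨f, hft, rfl, rfl, by omega⟩)
  have hchain : ∀ s ≤ l, edgeRel G.fst G.snd (e t) (i + 1) ((v (t + 1) : Fin G.n) + 1)
      ((v ⟨_, hmod s⟩ : Fin G.n) + 1) := fun s => by
    induction s with
    | zero =>
      intro _
      have : (t + 1 : Fin (l + 1)) = ⟨_, hmod 0⟩ := Fin.ext (by simp [Fin.val_add])
      rw [this]
    | succ s ih =>
      intro hs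
      refine Setoid.trans' _ (ih (by omega)) ?_
      have hlink := hcyc.isLink ⟨_, hmod s⟩
      rw [hsucc] at hlink
      exact hrel _ _ _ hlink (lt_of_le_of_ne (ht _) fun h' =>
        hne s (by omega) (hcyc.edge_injective (Fin.ext h')))
  have hlast : (⟨_, hmod l⟩ : Fin (l + 1)) = t := Fin.ext (by
    simp only
    rw [show (t : ℕ) + 1 + l = t + (l + 1) by ring, Nat.add_mod_right, Nat.mod_eq_of_lt t.2])
  have hfin := hchain l le_rfl
  rw [hlast] at hfin
  have hcomp := component_eq_of_isLink (hcyc.isLink t)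
  have hvc : (G.slice i j).toSimpleGraph.connectedComponentMk (v t) = c := hc t
  rcases (hcyc.isLink t).2 with he | he
  · refine ⟨e t, hi, hj, ?_, ?_⟩
    · rw [fst_val, snd_val, he]
      exact Setoid.symm' _ hfin
    · rw [he]
      exact hvc
  · refine ⟨e t, hi, hj, ?_, ?_⟩
    · rw [fst_val, snd_val, he]
      exact hfin
    · rw [he]
      exact hcomp.symm.trans hvc

/-! ### Counting components -/

theorem range_val (i j : ℕ) :
    Set.range (fun x : (G.slice i j).vertexSet => ((x : Fin G.n) : ℕ) + 1) = Set.Icc 1 G.n := by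
  ext a
  constructor
  · rintro ⟨x, rfl⟩
    exact ⟨Nat.le_add_left _ _, (x : Fin G.n).2⟩
  · rintro ⟨h1, h2⟩
    exact ⟨toSlice i j ⟨a - 1, by omega⟩, by simp [toSlice]; omega⟩

theorem fst_pos {k : ℕ} (hk : k < G.m) : 0 < G.fst k := by simp [fst, hk]

theorem snd_pos {k : ℕ} (hk : k < G.m) : 0 < G.snd k := by simp [snd, hk]

theorem not_edgeRel_zero (hj : j < G.m) (x : Fin G.n) :
    ¬ edgeRel G.fst G.snd (j + 1) (i + 1) (x + 1) 0 := by
  intro h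
  have hle : edgeRel G.fst G.snd (j + 1) (i + 1) ≤ Setoid.ker (fun a => a = 0) := by
    refine Setoid.eqvGen_le ?_
    rintro _ _ ⟨k, hk, rfl, rfl, -⟩
    have h1 := fst_pos (G := G) (k := k) (by omega)
    have h2 := snd_pos (G := G) (k := k) (by omega)
    rw [Setoid.ker_def]
    exact propext ⟨fun h => by omega, fun h => by omega⟩
  have := hle h
  rw [Setoid.ker_def] at this
  simp at this

section
variable {B : ℕ} {R : ℕ → ℕ → ℕ} {T₁ T₂ T₃ : BottleneckTree}

theorem card_component (hj : j < G.m) (hT : T₁.WF G.n B)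
    (h : History G.n G.fst G.snd R (j + 1) T₁ T₂ T₃) :
    Nat.card (G.slice i j).Component + T₁.heavyCount G.n (i + 1) = G.n := by
  have h' := hT.card_add_heavyCount (θ := i + 1) (G.slice i j).toSimpleGraph _ (range_val i j)
    (fun _ => True) (fun x => ?_) (fun x y _ => ?_)
  · rwa [Nat.card_congr (Equiv.subtypeUnivEquiv fun _ => trivial)] at h'
  · rw [h.rel₁ _ (by omega)]
    simpa using not_edgeRel_zero hj x
  · rw [h.rel₁ _ (by omega)]
    exact edgeRel_iff hj x y

/-! ### Loopy components as the class of the root. -/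

/-- The condition `i + 1 ≤ R 0 k` says that the edge lies in the slice and closes a cycle with
earlier edges. These are the edges that the second tree ties to the root. -/
theorem isLoopy_iff (hj : j < G.m) (h : History G.n G.fst G.snd R (j + 1) T₁ T₂ T₃)
    (c : (G.slice i j).Component) :
    (G.slice i j).IsLoopy c ↔ ∃ k : Fin G.m, (k : ℕ) ≤ j ∧ i + 1 ≤ R 0 k ∧
      (G.slice i j).toSimpleGraph.connectedComponentMk (toSlice i j (G.edge k).1) = c := by
  constructor
  · intro hc
    obtain ⟨k, hik, hkj, hk, hkc⟩ := exists_of_isLoopy hc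
    exact ⟨k, hkj, (h.le_iff k (by omega) _ (by omega)).2 ⟨by omega, hk⟩, hkc⟩
  · rintro ⟨k, hkj, hk, rfl⟩
    rw [h.le_iff k (by omega) _ (by omega)] at hk
    exact exists_cycle hj (by omega) hkj hk.2

theorem edgeRel_le_loopRel {U V f : ℕ → ℕ} {j θ : ℕ} : edgeRel U V j θ ≤ loopRel U V f j θ :=
  Setoid.eqvGen_mono fun _ _ ⟨k, hk, h1, h2, h3⟩ => ⟨k, hk, h1, .inl ⟨h2, h3⟩⟩

open Classical in
/-- The class of a vertex: its component, if this is a tree. -/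
noncomputable def treeClass (G : RelationalEventGraph) (i j a : ℕ) :
    Option (G.slice i j).Component :=
  if h : 1 ≤ a ∧ a ≤ G.n then
    if (G.slice i j).IsLoopy
      ((G.slice i j).toSimpleGraph.connectedComponentMk (toSlice i j ⟨a - 1, by omega⟩)) then none
    else some ((G.slice i j).toSimpleGraph.connectedComponentMk (toSlice i j ⟨a - 1, by omega⟩))
  else none

open Classical in
theorem treeClass_succ (x : Fin G.n) : G.treeClass i j (x + 1) =
    if (G.slice i j).IsLoopy ((G.slice i j).toSimpleGraph.connectedComponentMk (toSlice i j x))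
    then none else some ((G.slice i j).toSimpleGraph.connectedComponentMk (toSlice i j x)) := by
  have := x.2
  unfold treeClass
  rw [dif_pos ⟨by omega, by omega⟩]
  rfl

/-- An edge of the slice stays within a component, and an edge to the root starts in a loopy
component, which `treeClass` sends to `none` just like the root. -/
theorem loopRel_le (hj : j < G.m) (h : History G.n G.fst G.snd R (j + 1) T₁ T₂ T₃) :
    loopRel G.fst G.snd (R 0) (j + 1) (i + 1) ≤ Setoid.ker (G.treeClass i j) := by
  refine Setoid.eqvGen_le ?_
  rintro _ _ ⟨k, hk, rfl, ⟨rfl, hki⟩ | ⟨rfl, hkR⟩⟩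
  all_goals
    have hkm : k < G.m := by omega
    rw [Setoid.ker_def, show k = ((⟨k, hkm⟩ : Fin G.m) : ℕ) from rfl, fst_val, treeClass_succ]
  · have hcomp := component_eq_of_isLink (i := i) (j := j) (k := ⟨k, hkm⟩)
      (x := toSlice i j (G.edge ⟨k, hkm⟩).1) (y := toSlice i j (G.edge ⟨k, hkm⟩).2)
      ⟨⟨by simp; omega, by simp; omega⟩, .inl rfl⟩
    rw [snd_val, treeClass_succ, hcomp]
  · rw [if_pos ((isLoopy_iff hj h _).2 ⟨⟨k, hkm⟩, by simp; omega, hkR, rfl⟩)]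
    simp [treeClass]

theorem loopRel_zero_iff (hj : j < G.m) (h : History G.n G.fst G.snd R (j + 1) T₁ T₂ T₃)
    (x : (G.slice i j).vertexSet) :
    loopRel G.fst G.snd (R 0) (j + 1) (i + 1) ((x : Fin G.n) + 1) 0 ↔
      (G.slice i j).IsLoopy ((G.slice i j).toSimpleGraph.connectedComponentMk x) := by
  constructor
  · intro h'
    have := loopRel_le hj h h'
    rw [Setoid.ker_def, treeClass_succ, toSlice_val] at this
    by_contra hc
    rw [if_neg hc] at this
    simp [treeClass] at this
  · intro hc
    obtain ⟨k, hkj, hk, hkc⟩ := (isLoopy_iff hj h _).1 hc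
    rw [← edgeRel_iff hj] at hkc
    refine Setoid.trans' _ (Setoid.symm' _ (edgeRel_le_loopRel hkc))
      (.rel _ _ ⟨k, by omega, ?_, .inr ⟨rfl, hk⟩⟩)
    rw [fst_val]
    rfl

theorem card_treeComponent (hj : j < G.m) (hT : T₂.WF G.n B)
    (h : History G.n G.fst G.snd R (j + 1) T₁ T₂ T₃) :
    (G.slice i j).treeComponentCount + T₂.heavyCount G.n (i + 1) = G.n := by
  refine hT.card_add_heavyCount (θ := i + 1) (G.slice i j).toSimpleGraph _ (range_val i j) _
    (fun x => ?_) (fun x y hx => ?_)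
  · rw [h.rel₂ _ (by omega), loopRel_zero_iff hj h, Graph.IsTreeComponent, not_not]
  · rw [h.rel₂ _ (by omega)]
    constructor
    · intro h'
      have := loopRel_le hj h h'
      rw [Setoid.ker_def, treeClass_succ, treeClass_succ, toSlice_val, toSlice_val, if_neg hx] at this
      split_ifs at this
      exact Option.some_injective _ this
    · intro h'
      exact edgeRel_le_loopRel ((edgeRel_iff hj x y).2 h')

/-! ### Vertices without edges as the classes of the third tree. -/

/-- The vertex is an endpoint of an edge of the slice. -/
def Touched (G : RelationalEventGraph) (i j a : ℕ) : Prop :=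
  ∃ k, i ≤ k ∧ k ≤ j ∧ (a = G.fst k ∨ a = G.snd k)

open Classical in
theorem touchRel_le : touchRel G.fst G.snd (j + 1) (i + 1) ≤
    Setoid.ker fun a => if G.Touched i j a then 0 else a := by
  refine Setoid.eqvGen_le ?_
  rintro a _ ⟨k, hk, ha, rfl, hki⟩
  rw [Setoid.ker_def, if_pos ⟨k, by omega, by omega, ha⟩]
  simp

theorem touchRel_zero_iff {a : ℕ} (ha : a ≠ 0) :
    touchRel G.fst G.snd (j + 1) (i + 1) a 0 ↔ G.Touched i j a := by
  constructor
  · intro h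
    have := touchRel_le h
    rw [Setoid.ker_def] at this
    by_contra hc
    simp [hc, ha] at this
  · rintro ⟨k, hik, hkj, ha⟩
    exact .rel _ _ ⟨k, by omega, ha, rfl, by omega⟩

theorem eq_of_not_touched {x y : (G.slice i j).vertexSet}
    (hx : ¬ G.Touched i j ((x : Fin G.n) + 1))
    (h : (G.slice i j).toSimpleGraph.connectedComponentMk x =
      (G.slice i j).toSimpleGraph.connectedComponentMk y) : x = y := by
  obtain ⟨p⟩ := SimpleGraph.ConnectedComponent.exact h
  cases p with
  | nil => rfl
  | cons hadj p =>
    obtain ⟨-, k, hk, he⟩ := hadj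
    refine absurd ⟨k, hk.1, hk.2, ?_⟩ hx
    rcases edge_eq_or_iff.1 he with ⟨h1, h2⟩ | ⟨h1, h2⟩
    exacts [.inl h1.symm, .inr h2.symm]

/-- An untouched vertex is a component by itself and has no loop. An edge at a touched vertex leads
to a second vertex or is a loop, which is a cycle. -/
theorem touched_iff (hj : j < G.m) (h : History G.n G.fst G.snd R (j + 1) T₁ T₂ T₃)
    (x : (G.slice i j).vertexSet) :
    G.Touched i j ((x : Fin G.n) + 1) ↔
      ¬ ((G.slice i j).IsTreeComponent ((G.slice i j).toSimpleGraph.connectedComponentMk x) ∧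
        ¬ ((G.slice i j).toSimpleGraph.connectedComponentMk x).supp.Nontrivial) := by
  constructor
  · rintro ⟨k, hik, hkj, hx⟩ ⟨htree, htriv⟩
    have hkm : k < G.m := by omega
    set k' : Fin G.m := ⟨k, hkm⟩ with hk'
    have hlink : (G.slice i j).IsLink k' (toSlice i j (G.edge k').1 : Fin G.n)
        (toSlice i j (G.edge k').2 : Fin G.n) := ⟨⟨hik, hkj⟩, .inl rfl⟩
    have hcomp := component_eq_of_isLink hlink
    have hx' : x = toSlice i j (G.edge k').1 ∨ x = toSlice i j (G.edge k').2 := by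
      rw [show k = ((k' : Fin G.m) : ℕ) from rfl, fst_val, snd_val] at hx
      refine hx.imp (fun h => ?_) (fun h => ?_) <;>
      · apply Subtype.ext
        apply Fin.ext
        simp only [toSlice]
        omega
    have hc1 : (G.slice i j).toSimpleGraph.connectedComponentMk (toSlice i j (G.edge k').1) =
        (G.slice i j).toSimpleGraph.connectedComponentMk x := by
      rcases hx' with hx' | hx' <;> rw [hx']
      exact hcomp
    have hc2 := hcomp.symm.trans hc1
    rw [Set.not_nontrivial_iff] at htriv
    have heq := congrArg Subtype.val (htriv hc1 hc2)
    refine htree ?_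
    rw [← hc1]
    refine exists_cycle (k := k') hj hik hkj ?_
    rw [fst_val, snd_val]
    simp only [toSlice] at heq
    rw [heq]
  · intro hc
    by_contra hx
    refine hc ⟨fun hl => ?_, fun ⟨a, ha, b, hb, hab⟩ => hab ?_⟩
    · obtain ⟨k, hkj, hk, hkc⟩ := (isLoopy_iff hj h _).1 hl
      have := eq_of_not_touched hx hkc.symm
      have hki := (h.le_iff k (by omega) _ (by omega)).1 hk
      refine hx ⟨k, by omega, hkj, .inl ?_⟩
      rw [this, fst_val]
      rfl
    · rw [← eq_of_not_touched hx (SimpleGraph.ConnectedComponent.mem_supp_iff _ _ |>.1 ha).symm,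
        ← eq_of_not_touched hx (SimpleGraph.ConnectedComponent.mem_supp_iff _ _ |>.1 hb).symm]

theorem card_trivialTreeComponent (hj : j < G.m) (hT : T₃.WF G.n B)
    (h : History G.n G.fst G.snd R (j + 1) T₁ T₂ T₃) :
    Nat.card {c : (G.slice i j).Component //
      (G.slice i j).IsTreeComponent c ∧ ¬ c.supp.Nontrivial} +
      T₃.heavyCount G.n (i + 1) = G.n := by
  refine hT.card_add_heavyCount (θ := i + 1) (G.slice i j).toSimpleGraph _ (range_val i j) _
    (fun x => ?_) (fun x y hx => ?_)
  · rw [h.rel₃ _ (by omega), touchRel_zero_iff (by omega), touched_iff hj h]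
  · rw [h.rel₃ _ (by omega)]
    have hx' := mt (touched_iff hj h x).1 (not_not.2 hx)
    constructor
    · intro h'
      have := touchRel_le h'
      rw [Setoid.ker_def, if_neg hx'] at this
      split_ifs at this
      have hxy : x = y := Subtype.ext (Fin.ext (by omega))
      rw [hxy]
    · intro h'
      rw [eq_of_not_touched hx' h']

end

end RelationalEventGraph

/-! ## The reduction -/

theorem countP_range_eq_sum (p : ℕ → Bool) (M : ℕ) :
    (List.range M).countP p = ∑ k ∈ Finset.range M, if p k then 1 else 0 := by
  induction M with
  | zero => rfl
  | succ M ih =>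
    rw [List.range_succ, List.countP_append, ih, Finset.sum_range_succ, List.countP_singleton]

/-- The place of the points for the superfluous edges of kind `t`. -/
def removedLocation (t : ℕ) : PointSetLocation := ⟨1, 11, 12 + t⟩

section
variable {N M : ℕ} {U V : ℕ → ℕ} {σ : RAM.Memory}

/-- The point of `e_k` is `(k + 2, r_k + 1)`, so the query point `(j + 2, i + 2)` selects `k ≤ j`
and `r_k ≥ i + 1`. -/
theorem RAM.Final.dominanceCount_eq (h : RAM.Final N M U V σ) {t i j : ℕ} (ht : t < 5) (hj : j < M) :
    dominanceCount ((removedLocation t).points σ) ⟨true, false⟩ (j + 2) (i + 2) =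
      countGE (RAM.removed σ t) (j + 1) (i + 1) := by
  unfold dominanceCount PointSetLocation.points countGE removedLocation
  rw [List.countP_map, h.reg_one, countP_range_eq_sum]
  rw [← Finset.sum_subset (Finset.range_subset_range.2 (by omega : j + 1 ≤ M))]
  · refine Finset.sum_congr rfl fun k hk => ?_
    have hk' := Finset.mem_range.1 hk
    have h1 := h.arr_x k (by omega)
    have h2 := h.arr_y t ht k (by omega)
    simp only [Function.comp_apply, h1, RAM.removed, if_true, Bool.false_eq_true, if_false,
      Bool.and_eq_true, decide_eq_true_eq]
    congr 1
    exact propext (by omega)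
  · intro k hk hk'
    rw [Finset.mem_range] at hk hk'
    have h1 := h.arr_x k hk
    simp only [Function.comp_apply, h1, if_true, Bool.and_eq_true, decide_eq_true_eq]
    exact if_neg (by omega)

/-- The points have distinct first coordinates. These go up to `M + 1`, which is at most `2 * M` as
soon as there is a point. -/
theorem RAM.Final.isDominanceData (h : RAM.Final N M U V σ) {t : ℕ} (ht : t < 5) :
    IsDominanceData (2 * M) ((removedLocation t).points σ) := by
  obtain ⟨T₁, T₂, T₃, -, -, -, hist⟩ := h.history M le_rfl
  have hmem : ∀ k < M, σ.arr 11 k = k + 2 ∧ 1 ≤ σ.arr (12 + t) k ∧ σ.arr (12 + t) k ≤ k + 2 := by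
    intro k hk
    have h1 := hist.le_succ t ht k hk
    unfold RAM.removed at h1
    exact ⟨h.arr_x k hk, h.arr_y t ht k hk, by omega⟩
  unfold PointSetLocation.points removedLocation
  rw [h.reg_one]
  refine ⟨?_, by simp; omega, ?_⟩
  · refine List.Nodup.map_on (fun k hk l hl hkl => ?_) List.nodup_range
    have h1 := (hmem k (List.mem_range.1 hk)).1
    have h2 := (hmem l (List.mem_range.1 hl)).1
    have h3 := congrArg Prod.fst hkl
    simp only at h3
    omega
  · intro p hp
    obtain ⟨k, hk, rfl⟩ := List.mem_map.1 hp
    have hk' := List.mem_range.1 hk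
    have := hmem k hk'
    simp only
    omega

end

/-- The query for the number of superfluous edges of kind `t`, with weight at least `i + 1` and
found before time `j + 1`. -/
def removedQuery (coeff : ℤ) (t : ℕ) : DominanceQuery :=
  ⟨coeff, removedLocation t, ⟨true, false⟩, ⟨0, 0, 0, 1, 2⟩, ⟨0, 0, 1, 0, 2⟩⟩

/-- A quantity that depends linearly on the numbers of superfluous edges can be reduced to dominance
counting. -/
theorem reducesToDominanceCounting_of_linear {f : ∀ {n m : ℕ}, Graph (Fin n) (Fin m) → ℕ}
    (base : AffineForm) (c : ℕ → ℤ)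
    (hf : ∀ (G : RelationalEventGraph) (R : ℕ → ℕ → ℕ) (T₁ T₂ T₃ : BottleneckTree) (i j : ℕ),
      i ≤ j → j < G.m → T₁.WF G.n G.m → T₂.WF G.n G.m → T₃.WF G.n G.m →
      History G.n G.fst G.snd R (j + 1) T₁ T₂ T₃ →
      (f (G.slice i j) : ℤ) = base.eval G.n G.m i j +
        ∑ t ∈ Finset.range 5, c t * countGE (R t) (j + 1) (i + 1)) :
    ReducesToDominanceCounting f (fun n m => m * (Nat.log 2 n + 1) + 1) (fun n m => n + m + 1) := by
  refine ⟨RAM.mainProgram, ⟨base, (List.range 5).map fun t => removedQuery (c t) t⟩, 12000,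
    fun G => ?_⟩
  obtain ⟨t, σ, hrun, ht, hfin⟩ := RAM.exists_run_mainProgram G G.fst G.snd
    (fun k h => by simp [RelationalEventGraph.fst, h])
    (fun k h => by simp [RelationalEventGraph.snd, h])
  refine ⟨t, σ, hrun, ht, fun d hd => ?_, fun i j hij hj => ?_⟩
  · obtain ⟨t, ht, rfl⟩ := List.mem_map.1 hd
    exact ⟨2 * G.m, by omega, hfin.isDominanceData (List.mem_range.1 ht)⟩
  · obtain ⟨T₁, T₂, T₃, w₁, w₂, w₃, hist⟩ := hfin.history (j + 1) hj
    rw [hf G _ T₁ T₂ T₃ i j hij hj w₁ w₂ w₃ hist, QueryScheme.answer]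
    congr 1
    rw [List.map_map, Finset.sum_range, ← List.sum_ofFn, List.ofFn_eq_map,
      ← List.map_coe_finRange_eq_range, List.map_map]
    congr 1
    refine List.map_congr_left fun t _ => ?_
    simp only [Function.comp_apply, removedQuery, AffineForm.eval]
    rw [← hfin.dominanceCount_eq t.2 hj]
    congr 3 <;> ring

theorem countGE_succ_index {i j : ℕ} (hij : i ≤ j) :
    (countGE (· + 1) (j + 1) (i + 1) : ℤ) = j - i + 1 := by
  have h : countGE (· + 1) (j + 1) (i + 1) = (Finset.Ico i (j + 1)).card := by
    unfold countGE
    rw [← Finset.card_filter]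
    congr 1
    ext k
    simp only [Finset.mem_filter, Finset.mem_range, Finset.mem_Ico]
    omega
  rw [h, Nat.card_Ico]
  omega

theorem Nat.card_subtype_and_add {α : Type*} [Finite α] (p q : α → Prop) :
    Nat.card {a // p a ∧ q a} + Nat.card {a // p a ∧ ¬ q a} = Nat.card {a // p a} := by
  classical
  have := Fintype.ofFinite α
  simp only [Nat.card_eq_fintype_card, Fintype.card_subtype]
  rw [← Finset.filter_filter, ← Finset.filter_filter, Finset.card_filter_add_card_filter_not]

theorem Graph.loopyComponentCount_add {α β : Type*} [Finite α] (H : Graph α β) :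
    H.loopyComponentCount + H.treeComponentCount = Nat.card H.Component := by
  have : Finite H.Component := Quot.finite _
  have h := Nat.card_subtype_and_add (fun _ : H.Component => True) H.IsLoopy
  simp only [true_and] at h
  rwa [Nat.card_congr (Equiv.subtypeUnivEquiv fun _ => trivial)] at h

theorem Graph.nontrivialTreeComponentCount_add {α β : Type*} [Finite α] (H : Graph α β) :
    H.nontrivialTreeComponentCount +
      Nat.card {c : H.Component // H.IsTreeComponent c ∧ ¬ c.supp.Nontrivial} =
      H.treeComponentCount :=
  have : Finite H.Component := Quot.finite _
  Nat.card_subtype_and_add _ _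

theorem mainTheorem3 :
    ReducesToDominanceCounting (fun H => H.loopyComponentCount)
        (fun n m => m * (Nat.log 2 n + 1) + 1) (fun n m => n + m + 1) ∧
      ReducesToDominanceCounting (fun H => H.treeComponentCount)
        (fun n m => m * (Nat.log 2 n + 1) + 1) (fun n m => n + m + 1) ∧
      ReducesToDominanceCounting (fun H => H.nontrivialTreeComponentCount)
        (fun n m => m * (Nat.log 2 n + 1) + 1) (fun n m => n + m + 1) := by
  -- Put `ℓ = j - i + 1`, and let `C_t` be the number of superfluous weights of kind `t` that are
  -- counted. There are `n - ℓ + C_0` components, `n - ℓ - C_0 + C_1 + C_2` tree components and `n -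
  -- 2 * ℓ + C_3 + C_4` trivial ones. The coefficients are those of the differences.
  refine ⟨reducesToDominanceCounting_of_linear ⟨0, 0, 0, 0, 0⟩
      (fun t => if t = 0 then 2 else if t ≤ 2 then -1 else 0) ?_,
    reducesToDominanceCounting_of_linear ⟨1, 0, 1, -1, -1⟩
      (fun t => if t = 0 then -1 else if t ≤ 2 then 1 else 0) ?_,
    reducesToDominanceCounting_of_linear ⟨0, 0, -1, 1, 1⟩
      (fun t => if t = 0 then -1 else if t ≤ 2 then 1 else -1) ?_⟩ <;>
  · intro G R T₁ T₂ T₃ i j hij hj w₁ w₂ w₃ hist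
    have h1 := RelationalEventGraph.card_component (i := i) hj w₁ hist
    have h2 := RelationalEventGraph.card_treeComponent (i := i) hj w₂ hist
    have h3 := RelationalEventGraph.card_trivialTreeComponent (i := i) hj w₃ hist
    have h4 := (G.slice i j).loopyComponentCount_add
    have h5 := (G.slice i j).nontrivialTreeComponentCount_add
    have c1 := hist.count₁ (i + 1) (by omega)
    have c2 := hist.count₂ (i + 1) (by omega)
    have c3 := hist.count₃ (i + 1) (by omega)
    have c4 := countGE_succ_index hij
    simp [Finset.sum_range_succ, AffineForm.eval]
    omega
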